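/- **Conventions.** Let $r\ge 1$ and let $a_0,\dots,a_r$ be integers with $1=a_0<a_1<\cdots<a_{r-1}<a_r=n$. Let $0=s_0<s_1<\cdots<s_\ell=r$ be integers. We identify partitions with Young diagrams, drawn left- and upward-justified; $\mu\subset(n-1)^r$ means that $\mu$ has at most $r$ parts, all at most $n-1$. The cohomology ring of the Grassmannian of $r$-planes in $\mathbb{C}^N$ is taken with integer coefficients, in its standard presentation $$H^*(\mathrm{Gr}(r,N))=\mathbb{Z}[x_1,\dots,x_r]^{S_r}\big/\big(h_m(x_1,\dots,x_r): m>N-r\big),$$ where the $x_i$ are the Chern roots of the dual tautological subbundle and $h_m=c_m(Q)$ is the complete homogeneous symmetric polynomial, the $m$-th Chern class of the quotient bundle $Q$. For a partition $\lambda=(\lambda_1\ge\cdots\ge\lambda_r\ge0)$ with $\lambda_1\le N-r$, $\sigma_\lambda=\det(h_{\lambda_i+j-i})_{1\le i,j\le r}$ is the corresponding Schubert class (with $h_k=0$ for $k<0$). The exponent in $(n-1)^{k},p$ denotes $k$ parts equal to $n-1$, followed by one part $p$. A *semistandard Young tableau* (SSYT) of shape $\mu\subset(n-1)^r$ is a filling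 of the boxes of $\mu$ with entries in $\{1,\dots,r\}$, weakly increasing along rows and strictly increasing down columns. Its *$i$-weight* is the number of boxes filled with $i$. A *strip* of $\mu$ is a set of $n-1$ boxes of $\mu$, no two in the same column, such that whenever a box $b_1$ of the set lies in a column to the left of another box $b_2$ of the set, $b_1$ does not lie in a row above $b_2$. An *$(i,i+1)$-strip* of an SSYT is a strip all of whose boxes are filled with $i$ or $i+1$, all instances of $i$ in it lying to the left of all instances of $i+1$ (one of the two entries may be absent). **Proposition.** In $H^*(\mathrm{Gr}(r,n+r-1))$, the Schubert classes $\sigma_\mu$ with $\mu\subset(n-1)^r$ are linearly independent over $\mathbb{Z}$, and $$\prod_{j=1}^{\ell}\sigma_{(n-1)^{s_j-s_{j-1}-1},\;n-1-(a_{s_j}-a_{s_{j-1}})}=\sum_{\substack{\mu\subset(n-1)^r\\ |\mu|=(n-1)(r-1)}}c_\mu\,\sigma_\mu,$$ where $c_\mu$ is the number of SSYTs of shape $\mu$ such that - the $i$-weight is $n-1-(a_i-a_{i-1})$ for every $i=1,\dots,r$, and - the tableau contains an $(i,i+1)$-strip for every $i\in\{1,\dots,r-1\}\setminus\{s_1,\dots,s_{\ell-1}\}$.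 -/

import Mathlib

/-! ## The cohomology ring of a Grassmannian and its Schubert classes

The integral cohomology ring of `Gr(r, N)` is generated by the Chern classes of the tautological
bundles `0 → S → ℂ^N → Q → 0`, and the relations between them are generated by the Whitney
relations `c(S) c(Q) = 1`. Let `x₁, …, x_r` be the Chern roots of the dual of `S`. Then
`c_m(Q) = h_m(x₁, …, x_r)` is the complete homogeneous symmetric polynomial, the classes `c_i(S)`
are up to sign the elementary symmetric polynomials in the `x_i`, which generate freely the ring of
symmetric polynomials, and the remaining relations say that `c_m(Q)` vanishes for `m > N - r`. -/

/-- The complete homogeneous symmetric polynomial `h_m(x₁, …, x_r)`, as an element of the ring of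
symmetric polynomials with integer coefficients. -/
noncomputable def completeSym (r m : ℕ) : MvPolynomial.symmetricSubalgebra (Fin r) ℤ :=
  ⟨MvPolynomial.hsymm (Fin r) ℤ m, MvPolynomial.hsymm_isSymmetric (Fin r) ℤ m⟩

/-- The ideal of relations `h_m = 0` for `m > N - r` (written `N < r + m`, so that no truncated
subtraction is involved). -/
noncomputable def grassmannianIdeal (r N : ℕ) :
    Ideal (MvPolynomial.symmetricSubalgebra (Fin r) ℤ) :=
  Ideal.span {f | ∃ m : ℕ, N < r + m ∧ f = completeSym r m}

/-- The integral cohomology ring `H^*(Gr(r, N))` of the Grassmannian of `r`-dimensional subspaces of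
`ℂ^N`, in its standard presentation: symmetric polynomials in the Chern roots of the dual
tautological subbundle, modulo the vanishing of the Chern classes of the quotient bundle in degrees
greater than its rank `N - r`. -/
abbrev GrassmannianCohomology (r N : ℕ) : Type :=
  MvPolynomial.symmetricSubalgebra (Fin r) ℤ ⧸ grassmannianIdeal r N

/-- The special Schubert class `σ_k = c_k(Q)`, with the convention that it is `0` for `k < 0`. -/
noncomputable def specialSchubertClass (r N : ℕ) (k : ℤ) : GrassmannianCohomology r N :=
  if 0 ≤ k then Ideal.Quotient.mk (grassmannianIdeal r N) (completeSym r k.toNat) else 0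

/-- The Schubert class `σ_lam` of a partition `lam = (lam 0 ≥ lam 1 ≥ ⋯ ≥ lam (r - 1) ≥ 0)` with
`lam 0 ≤ N - r`: the class in degree `2|lam|` of the Schubert variety of subspaces `V` with
`dim (V ∩ F_{N - r + i - lam_i}) ≥ i` for `1 ≤ i ≤ r`. It is given by the determinant
`det (σ_{lam_i + j - i})` in the special Schubert classes (Giambelli), that is, by the Schur
polynomial of `lam` in the Chern roots. -/
noncomputable def schubertClass (r N : ℕ) (lam : Fin r → ℕ) : GrassmannianCohomology r N :=
  Matrix.det (Matrix.of fun i j : Fin r =>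
    specialSchubertClass r N ((lam i : ℤ) + ((j : ℕ) : ℤ) - ((i : ℕ) : ℤ)))

/-! ## Partitions in a rectangle -/

/-- Partitions `μ ⊂ m^r`: Young diagrams with at most `r` rows and at most `m` columns. The cell
`(i, j)` lies in row `i` (counted from the top) and column `j` (counted from the left), both counted
from `0`. -/
def BoxPartition (r m : ℕ) : Type :=
  {μ : YoungDiagram // ∀ c ∈ μ.cells, c.1 < r ∧ c.2 < m}

/-- There are finitely many partitions in a given rectangle. -/
instance BoxPartition.instFinite (r m : ℕ) : Finite (BoxPartition r m) := by
  let f : BoxPartition r m → (Finset.range r ×ˢ Finset.range m).powerset := fun μ =>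
    ⟨μ.1.cells, by
      rw [Finset.mem_powerset]
      intro c hc
      simpa [Finset.mem_product] using μ.2 c hc⟩
  refine Finite.of_injective f ?_
  intro μ ν h
  apply Subtype.ext
  apply YoungDiagram.ext
  exact congrArg Subtype.val h

noncomputable instance BoxPartition.instFintype (r m : ℕ) : Fintype (BoxPartition r m) :=
  Fintype.ofFinite _

/-- The parts `(μ_1, …, μ_r)` of a partition with at most `r` parts. -/
def BoxPartition.parts {r m : ℕ} (μ : BoxPartition r m) : Fin r → ℕ :=
  fun i => μ.1.rowLen i

/-- The partition `(m^k, p, 0, …, 0)` with `k` parts equal to `m`, followed by one part `p`. -/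
def rectanglePlusPart (r m k p : ℕ) : Fin r → ℕ :=
  fun i => if (i : ℕ) < k then m else if (i : ℕ) = k then p else 0

/-! ## Weights and strips of tableaux -/

/-- The `k`-weight of a tableau: the number of boxes filled with the entry `k`. -/
def tableauWeight {μ : YoungDiagram} (T : SemistandardYoungTableau μ) (k : ℕ) : ℕ :=
  (μ.cells.filter fun c => T c.1 c.2 = k).card

/-- A strip of a diagram `μ` with at most `m` columns: a set of `m` boxes of `μ`, no two in the same
column, such that a box to the left of another one never lies in a row above it. -/
def IsStrip (m : ℕ) (μ : YoungDiagram) (S : Finset (ℕ × ℕ)) : Prop :=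
  S ⊆ μ.cells ∧ S.card = m ∧
    (∀ b₁ ∈ S, ∀ b₂ ∈ S, b₁ ≠ b₂ → b₁.2 ≠ b₂.2) ∧
    ∀ b₁ ∈ S, ∀ b₂ ∈ S, b₁.2 < b₂.2 → ¬ b₁.1 < b₂.1

/-- An `(i, i+1)`-strip of a tableau `T`: a strip all of whose boxes are filled with `i` or `i + 1`,
all instances of `i` lying to the left of all instances of `i + 1`. (One of the two entries may be
missing.) -/
def IsConsecutiveStrip (m : ℕ) {μ : YoungDiagram} (T : SemistandardYoungTableau μ) (i : ℕ)
    (S : Finset (ℕ × ℕ)) : Prop :=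
  IsStrip m μ S ∧ (∀ b ∈ S, T b.1 b.2 = i ∨ T b.1 b.2 = i + 1) ∧
    ∀ b₁ ∈ S, ∀ b₂ ∈ S, T b₁.1 b₁.2 = i → T b₂.1 b₂.2 = i + 1 → b₁.2 < b₂.2

/-- The semistandard tableaux of shape `μ ⊂ (n-1)^r` with entries in `{1, …, r}`, with `i`-weight
`n - 1 - (a_i - a_{i-1})` for `i = 1, …, r`, and with an `(i, i+1)`-strip (of `n - 1` boxes) for every
`i ∈ {1, …, r-1}` that does not belong to `A`. -/
def tableauxWithStrips (n r : ℕ) (a : Fin (r + 1) → ℕ) (A : Set (Fin (r + 1)))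
    (μ : YoungDiagram) : Set (SemistandardYoungTableau μ) :=
  {T | (∀ c ∈ μ.cells, 1 ≤ T c.1 c.2 ∧ T c.1 c.2 ≤ r) ∧
    (∀ i : Fin r, tableauWeight T ((i : ℕ) + 1) = n - 1 - (a i.succ - a i.castSucc)) ∧
    ∀ i : Fin (r + 1), i ≠ 0 → i ≠ Fin.last r → i ∉ A →
      ∃ S, IsConsecutiveStrip (n - 1) T i S}

/-! Put m = n - 1 and d_i = a_i - a_{i-1}. A tableau with at most m columns is determined by the
sets E_i of columns containing the entry i. Conversely, sets E_1, …, E_r come from a tableau exactly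
when every partial sum of their indicator functions is weakly decreasing: these partial sums
(`colSums`) are the column lengths of the subdiagrams of entries ≤ t. The weight condition says that
the complement of E_i has d_i elements. An (i, i+1)-strip exists exactly when every column without
i+1 lies strictly to the left of every column without i (`exists_isConsecutiveStrip_iff`).

Without strip conditions, summing Schubert classes over such sequences is the iterated rule of Pieri
(`prod_pieriClass`) and gives the product of the σ_{m - d_i}. A strip condition is removed by
merging: replace (E_i, E_{i+1}) by (all columns, E_i ∩ E_{i+1}). The condition makes the two
complements disjoint, so the sum of the indicators, hence the shape, is unchanged. The merge is
reversible: the complement of E_{i+1} is recovered as the leftmost d_{i+1} elements of the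
complement of the intersection (`sum_isColSequence_merge`). Merging through a block from s_{j-1} to
s_j leaves full sets and one last set whose complement has a_{s_j} - a_{s_{j-1}} elements. Pieri's
rule then gives a power of σ_m times one special class. Multiplication by σ_m puts a full row on top
of the diagram, so this product is the Schubert class of a rectangle with one further part
(`schubertClass_rectanglePlusPart`).

Pieri's rule and linear independence are both proved after multiplication by the Vandermonde
determinant, which turns Schur polynomials into alternants (`schurSym_mul_vandermonde`). The
relations of the Grassmannian then become polynomials in which every monomial has an exponent ≥ N.
The leading exponents of the alternants belonging to partitions in the rectangle are all < N, so
these alternants remain independent. -/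

/-! ## Complete homogeneous symmetric polynomials and alternants -/

open MvPolynomial Finset in
/-- The complete homogeneous symmetric polynomial is the sum of all monomials of its degree. -/
theorem hsymm_eq_sum_piAntidiag (r p : ℕ) :
    hsymm (Fin r) ℤ p = ∑ β ∈ piAntidiag (univ : Finset (Fin r)) p, ∏ i, X i ^ β i := by
  rw [← map_sym_eq_piAntidiag, sum_map, hsymm, Finset.sym_univ]
  refine Finset.sum_congr rfl fun s _ => ?_
  rw [Finset.prod_multiset_map_count]
  refine Finset.prod_subset (Finset.subset_univ _) fun i _ hi => ?_
  have : s.1.count i = 0 := by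
    rw [Multiset.count_eq_zero]
    exact fun h => hi (Multiset.mem_toFinset.2 h)
  rw [this, pow_zero]

/-- The alternant `det (x_l ^ α_i)`. -/
noncomputable def alternant {r : ℕ} (α : Fin r → ℕ) : MvPolynomial (Fin r) ℤ :=
  Matrix.det (Matrix.of fun l i : Fin r => MvPolynomial.X l ^ α i)

-- Since h_p is symmetric, the determinant term of τ may be multiplied by h_p written in the
-- variables x_{τ i}; the exponent β_i is then simply added to α_i.
open MvPolynomial Finset in
theorem hsymm_mul_alternant {r : ℕ} (p : ℕ) (α : Fin r → ℕ) :
    hsymm (Fin r) ℤ p * alternant α =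
      ∑ β ∈ piAntidiag (univ : Finset (Fin r)) p, alternant (α + β) := by
  simp only [alternant, Matrix.det_apply', Matrix.of_apply, Pi.add_apply, pow_add]
  rw [Finset.sum_comm, Finset.mul_sum]
  refine Finset.sum_congr rfl fun τ _ => ?_
  have h : hsymm (Fin r) ℤ p =
      ∑ β ∈ piAntidiag (univ : Finset (Fin r)) p, ∏ i, (X (τ i) : MvPolynomial (Fin r) ℤ) ^ β i := by
    rw [← rename_hsymm (Fin r) ℤ p τ, hsymm_eq_sum_piAntidiag]
    simp [map_sum, map_prod]
  rw [h, Finset.sum_mul]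
  refine Finset.sum_congr rfl fun β _ => ?_
  rw [Finset.prod_mul_distrib]
  ring

theorem alternant_comp_swap {r : ℕ} (γ : Fin r → ℕ) {i j : Fin r} (h : i ≠ j) :
    alternant (γ ∘ Equiv.swap i j) = -alternant γ := by
  have := Matrix.det_permute' (Equiv.swap i j)
    (Matrix.of fun l i : Fin r => (MvPolynomial.X l : MvPolynomial (Fin r) ℤ) ^ γ i)
  rw [Equiv.Perm.sign_swap h] at this
  exact this.trans (by simp [alternant])

theorem alternant_eq_zero {r : ℕ} (γ : Fin r → ℕ) {i j : Fin r} (h : i ≠ j) (hγ : γ i = γ j) :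
    alternant γ = 0 :=
  Matrix.det_zero_of_column_eq h fun l => by simp [hγ]

/-- The position `i` violates the horizontal strip condition for the exponents `α + β`. -/
def StripViolation {r : ℕ} (α β : Fin r → ℕ) (k : ℕ) : Prop :=
  ∃ h : k + 1 < r, α ⟨k, k.lt_succ_self.trans h⟩ ≤ α ⟨k + 1, h⟩ + β ⟨k + 1, h⟩

open Classical in
/-- The last violation of the horizontal strip condition. -/
noncomputable def lastViolation {r : ℕ} (α β : Fin r → ℕ) : ℕ :=
  Nat.findGreatest (StripViolation α β) r

theorem lastViolation_spec {r : ℕ} {α β : Fin r → ℕ} {k : ℕ} (hk : StripViolation α β k) :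
    StripViolation α β (lastViolation α β) := by
  classical
  obtain ⟨h, _⟩ := id hk
  exact Nat.findGreatest_spec (by omega) hk

theorem lastViolation_eq {r : ℕ} {α β : Fin r → ℕ} {k : ℕ} (hk : StripViolation α β k)
    (hlast : ∀ l, k < l → ¬ StripViolation α β l) : lastViolation α β = k := by
  classical
  obtain ⟨h, _⟩ := id hk
  exact Nat.findGreatest_eq_iff.2 ⟨by omega, fun _ => hk, fun _ hl _ => hlast _ hl⟩

theorem not_stripViolation_of_lastViolation_lt {r : ℕ} {α β : Fin r → ℕ} {l : ℕ}
    (hl : lastViolation α β < l) : ¬ StripViolation α β l := by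
  classical
  rintro hv
  obtain ⟨h, _⟩ := id hv
  exact Nat.findGreatest_is_greatest hl (by omega) hv

/-- Exchange the entries `k` and `k + 1` of `α + β`. -/
def swapExponents {r : ℕ} (α β : Fin r → ℕ) (k : ℕ) : Fin r → ℕ :=
  if h : k + 1 < r then
    fun i => (α + β) (Equiv.swap ⟨k, k.lt_succ_self.trans h⟩ ⟨k + 1, h⟩ i) - α i
  else β

/-- The subtraction in `swapExponents` does not truncate: at k this is the violation itself, at k +
1 it follows from α being strictly decreasing. -/
theorem add_swapExponents {r : ℕ} {α β : Fin r → ℕ} (hα : StrictAnti α) {k : ℕ} (h : k + 1 < r)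
    (hv : StripViolation α β k) :
    α + swapExponents α β k =
      (α + β) ∘ Equiv.swap ⟨k, k.lt_succ_self.trans h⟩ ⟨k + 1, h⟩ := by
  obtain ⟨_, hv⟩ := hv
  have hlt : α ⟨k + 1, h⟩ < α ⟨k, k.lt_succ_self.trans h⟩ := hα (by simp [Fin.lt_def])
  funext i
  simp only [swapExponents, h, dif_pos, Pi.add_apply, Function.comp_apply]
  refine Nat.add_sub_cancel' ?_
  rcases eq_or_ne i ⟨k, k.lt_succ_self.trans h⟩ with rfl | h1
  · rw [Equiv.swap_apply_left]; exact hv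
  rcases eq_or_ne i ⟨k + 1, h⟩ with rfl | h2
  · rw [Equiv.swap_apply_right]; omega
  · rw [Equiv.swap_apply_of_ne_of_ne h1 h2]; omega

theorem stripViolation_swapExponents {r : ℕ} {α β : Fin r → ℕ} (hα : StrictAnti α) {k : ℕ}
    (hv : StripViolation α β k) : StripViolation α (swapExponents α β k) k := by
  obtain ⟨h, _⟩ := id hv
  have hlt : α ⟨k + 1, h⟩ < α ⟨k, k.lt_succ_self.trans h⟩ := hα (by simp [Fin.lt_def])
  refine ⟨h, ?_⟩
  have := congrFun (add_swapExponents hα h hv) ⟨k + 1, h⟩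
  simp only [Pi.add_apply, Function.comp_apply, Equiv.swap_apply_right] at this
  omega

/-- A violation at l only involves α_l and the entry l + 1 of α + β, which the exchange of k and k +
1 leaves alone for l > k. Hence exchanging at the last violation is an involution. -/
theorem stripViolation_swapExponents_iff {r : ℕ} {α β : Fin r → ℕ} (hα : StrictAnti α) {k l : ℕ}
    (hv : StripViolation α β k) (hl : k < l) :
    StripViolation α (swapExponents α β k) l ↔ StripViolation α β l := by
  obtain ⟨h, _⟩ := id hv
  refine exists_congr fun h' => ?_
  have := congrFun (add_swapExponents hα h hv) ⟨l + 1, h'⟩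
  rw [Function.comp_apply, Equiv.swap_apply_of_ne_of_ne (by simp; omega) (by simp; omega)] at this
  simp only [Pi.add_apply] at this
  rw [this]

theorem lastViolation_swapExponents {r : ℕ} {α β : Fin r → ℕ} (hα : StrictAnti α) {k : ℕ}
    (hv : StripViolation α β k) :
    lastViolation α (swapExponents α β (lastViolation α β)) = lastViolation α β :=
  lastViolation_eq (stripViolation_swapExponents hα (lastViolation_spec hv)) fun _ hl h =>
    not_stripViolation_of_lastViolation_lt hl
      ((stripViolation_swapExponents_iff hα (lastViolation_spec hv) hl).1 h)

theorem swapExponents_swapExponents {r : ℕ} {α β : Fin r → ℕ} (hα : StrictAnti α) {k : ℕ}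
    (hv : StripViolation α β k) : swapExponents α (swapExponents α β k) k = β := by
  obtain ⟨h, _⟩ := id hv
  have h1 := add_swapExponents hα h (stripViolation_swapExponents hα hv)
  rw [add_swapExponents hα h hv, Function.comp_assoc] at h1
  rw [← add_right_inj α, h1]
  funext i
  simp

open Finset in
open Classical in
/-- Pieri's rule for alternants. -/
theorem hsymm_mul_alternant_eq_sum_strips {r : ℕ} (p : ℕ) {α : Fin r → ℕ} (hα : StrictAnti α) :
    MvPolynomial.hsymm (Fin r) ℤ p * alternant α =
      ∑ β ∈ piAntidiag (univ : Finset (Fin r)) p with ∀ k, ¬ StripViolation α β k,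
        alternant (α + β) := by
  rw [hsymm_mul_alternant, ← Finset.sum_filter_add_sum_filter_not _
    (fun β => ∀ k, ¬ StripViolation α β k), add_eq_left]
  refine Finset.sum_involution (fun β _ => swapExponents α β (lastViolation α β)) ?_ ?_ ?_ ?_
  · intro β hβ
    simp only [mem_filter, not_forall, not_not] at hβ
    obtain ⟨-, k, hk⟩ := hβ
    have hk' := lastViolation_spec hk
    obtain ⟨h, _⟩ := id hk'
    rw [add_swapExponents hα h hk', alternant_comp_swap _ (by simp), add_neg_cancel]
  -- At a fixed point the two exchanged exponents agree, so the alternant has two equal columns and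
  -- vanishes.
  · intro β hβ h0 heq
    simp only [mem_filter, not_forall, not_not] at hβ
    obtain ⟨-, k, hk⟩ := hβ
    have hk' := lastViolation_spec hk
    obtain ⟨h, _⟩ := id hk'
    have h1 := congrFun (add_swapExponents hα h hk') ⟨lastViolation α β + 1, h⟩
    rw [heq, Function.comp_apply, Equiv.swap_apply_right] at h1
    exact h0 (alternant_eq_zero _ (by simp) h1)
  · intro β hβ
    simp only [mem_filter, not_forall, not_not, mem_piAntidiag, mem_univ, implies_true,
      and_true] at hβ ⊢
    obtain ⟨hp, k, hk⟩ := hβ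
    have hk' := lastViolation_spec hk
    obtain ⟨h, _⟩ := id hk'
    refine ⟨?_, _, stripViolation_swapExponents hα hk'⟩
    have h1 := congrArg (fun f : Fin r → ℕ => ∑ i, f i) (add_swapExponents hα h hk')
    simp only [Function.comp_apply] at h1
    rw [Equiv.sum_comp (Equiv.swap _ _) (α + β)] at h1
    simp only [Pi.add_apply, Finset.sum_add_distrib] at h1
    exact (Nat.add_left_cancel h1).trans hp
  · intro β hβ
    simp only [mem_filter, not_forall, not_not] at hβ
    obtain ⟨-, k, hk⟩ := hβ
    rw [lastViolation_swapExponents hα hk, swapExponents_swapExponents hα (lastViolation_spec hk)]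

/-! ## The Jacobi–Trudi identity and Pieri's rule -/

open PowerSeries in
theorem mk_pow_mul_one_sub {R : Type*} [CommRing R] (x : R) :
    (PowerSeries.mk fun k => x ^ k) * (1 - C x * X) = 1 := by
  ext n
  cases n with
  | zero => simp [mul_sub, ← mul_assoc]
  | succ n => simp [mul_sub, ← mul_assoc, coeff_succ_mul_X, coeff_one, pow_succ]

open PowerSeries in
theorem mk_hsymm_eq_prod (r : ℕ) :
    (PowerSeries.mk fun k => MvPolynomial.hsymm (Fin r) ℤ k) =
      ∏ i : Fin r, PowerSeries.mk fun k => (MvPolynomial.X i : MvPolynomial (Fin r) ℤ) ^ k := by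
  ext1 p
  rw [coeff_mk, hsymm_eq_sum_piAntidiag, coeff_prod]
  refine Finset.sum_nbij' (fun β => Finsupp.equivFunOnFinite.symm β) (fun s => s) ?_ ?_ ?_ ?_ ?_ <;>
    simp [Finset.mem_finsuppAntidiag]

/-- The polynomial `∏ (1 - x_i t)` over all `i ≠ l`. -/
noncomputable def reciprocalProd (r : ℕ) (l : Fin r) : Polynomial (MvPolynomial (Fin r) ℤ) :=
  ∏ i ∈ Finset.univ.erase l, (1 - Polynomial.C (MvPolynomial.X i) * Polynomial.X)

theorem natDegree_reciprocalProd_lt (r : ℕ) (l : Fin r) : (reciprocalProd r l).natDegree < r := by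
  have h : (reciprocalProd r l).natDegree ≤ ∑ i ∈ Finset.univ.erase l, 1 := by
    refine (Polynomial.natDegree_prod_le _ _).trans (Finset.sum_le_sum fun i _ => ?_)
    compute_degree
  rw [Finset.sum_const, Finset.card_erase_of_mem (Finset.mem_univ _), Finset.card_univ,
    Fintype.card_fin, smul_eq_mul, mul_one] at h
  have := l.pos
  omega

-- The generating series of the h_k is ∏ 1 / (1 - x_i t); all factors except the one for l cancel.
open PowerSeries in
theorem mk_hsymm_mul_reciprocalProd (r : ℕ) (l : Fin r) :
    (PowerSeries.mk fun k => MvPolynomial.hsymm (Fin r) ℤ k) * (reciprocalProd r l : _⟦X⟧) =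
      PowerSeries.mk fun k => (MvPolynomial.X l : MvPolynomial (Fin r) ℤ) ^ k := by
  have h : ((reciprocalProd r l : Polynomial _) : (MvPolynomial (Fin r) ℤ)⟦X⟧) =
      ∏ i ∈ Finset.univ.erase l, (1 - C (MvPolynomial.X i) * X) := by
    rw [reciprocalProd, ← Polynomial.coeToPowerSeries.ringHom_apply, map_prod]
    simp
  rw [mk_hsymm_eq_prod, h, ← Finset.mul_prod_erase _ _ (Finset.mem_univ l), mul_assoc,
    ← Finset.prod_mul_distrib, Finset.prod_eq_one, mul_one]
  exact fun i _ => mk_pow_mul_one_sub _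

-- Compares coefficients of t^k. The r coefficients indexed by `Fin r` suffice because the
-- reciprocal product has degree less than r.
open Finset in
theorem sum_hsymm_mul_coeff (r : ℕ) (l : Fin r) (k : ℕ) :
    ∑ d : Fin r, (if (d : ℕ) ≤ k then MvPolynomial.hsymm (Fin r) ℤ (k - d) else 0) *
      (reciprocalProd r l).coeff d = MvPolynomial.X l ^ k := by
  have h := congrArg (PowerSeries.coeff k) (mk_hsymm_mul_reciprocalProd r l)
  rw [PowerSeries.coeff_mk, mul_comm, PowerSeries.coeff_mul, Nat.sum_antidiagonal_eq_sum_range_succ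
    (fun a b => PowerSeries.coeff a (reciprocalProd r l : PowerSeries _) *
      PowerSeries.coeff b (PowerSeries.mk fun k => MvPolynomial.hsymm (Fin r) ℤ k))] at h
  rw [← h, Fin.sum_univ_eq_sum_range (fun d => (if d ≤ k then MvPolynomial.hsymm (Fin r) ℤ (k - d)
    else 0) * (reciprocalProd r l).coeff d)]
  simp only [Polynomial.coeff_coe, PowerSeries.coeff_mk, ite_mul, zero_mul]
  rw [← Finset.sum_filter]
  have hsub : (range r).filter (· ≤ k) ⊆ range (k + 1) := fun d hd => by
    simp only [mem_filter, mem_range] at hd ⊢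
    omega
  rw [← Finset.sum_subset hsub fun d hd hd' => ?_]
  · exact Finset.sum_congr rfl fun _ _ => mul_comm _ _
  · simp only [mem_filter, mem_range] at hd hd'
    rw [Polynomial.coeff_eq_zero_of_natDegree_lt, zero_mul]
    exact (natDegree_reciprocalProd_lt r l).trans_le (by omega)

theorem coe_completeSym (r p : ℕ) :
    (completeSym r p : MvPolynomial (Fin r) ℤ) = MvPolynomial.hsymm (Fin r) ℤ p :=
  rfl

/-- The exponents `lam_i + r - 1 - i`. -/
def shiftedParts {r : ℕ} (lam : Fin r → ℕ) (i : Fin r) : ℕ := lam i + (r - 1 - i)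

theorem shiftedParts_strictAnti {r : ℕ} {lam : Fin r → ℕ} (h : Antitone lam) :
    StrictAnti (shiftedParts lam) := by
  intro i j hij
  have h1 := h hij.le
  have h2 : (i : ℕ) < j := hij
  have := j.isLt
  simp only [shiftedParts]
  omega

/-- The Schur polynomial, as a determinant of complete homogeneous symmetric polynomials. -/
noncomputable def schurSym (r : ℕ) (lam : Fin r → ℕ) : MvPolynomial.symmetricSubalgebra (Fin r) ℤ :=
  Matrix.det (Matrix.of fun i j : Fin r =>
    if 0 ≤ (lam i : ℤ) + ((j : ℕ) : ℤ) - ((i : ℕ) : ℤ) then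
      completeSym r ((lam i : ℤ) + ((j : ℕ) : ℤ) - ((i : ℕ) : ℤ)).toNat else 0)

theorem schubertClass_eq_mk (r N : ℕ) (lam : Fin r → ℕ) :
    schubertClass r N lam = Ideal.Quotient.mk (grassmannianIdeal r N) (schurSym r lam) := by
  rw [schubertClass, schurSym]
  refine Eq.trans ?_ (RingHom.map_det (S := GrassmannianCohomology r N)
    (Ideal.Quotient.mk (grassmannianIdeal r N)) _).symm
  congr 1
  ext i j
  simp only [Matrix.of_apply, specialSchubertClass, RingHom.mapMatrix_apply, Matrix.map_apply,
    apply_ite (Ideal.Quotient.mk (grassmannianIdeal r N)), map_zero]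

/-- Rewriting lam_i + j - i as (lam_i + r - 1 - i) - (r - 1 - j) brings the Giambelli matrix to the
form of `det_hsymm_mul_det_coeff`. -/
theorem coe_schurSym (r : ℕ) (lam : Fin r → ℕ) :
    (schurSym r lam : MvPolynomial (Fin r) ℤ) =
      Matrix.det (Matrix.of fun i j : Fin r =>
        if (j.rev : ℕ) ≤ shiftedParts lam i then
          MvPolynomial.hsymm (Fin r) ℤ (shiftedParts lam i - j.rev) else 0) := by
  rw [schurSym, ← Subalgebra.coe_val, AlgHom.map_det]
  congr 1
  ext1 i j
  simp only [Matrix.of_apply, AlgHom.mapMatrix_apply, Matrix.map_apply, Subalgebra.coe_val]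
  have h : 0 ≤ (lam i : ℤ) + ((j : ℕ) : ℤ) - ((i : ℕ) : ℤ) ↔ (j.rev : ℕ) ≤ shiftedParts lam i := by
    rw [shiftedParts, Fin.val_rev]
    omega
  by_cases h' : (j.rev : ℕ) ≤ shiftedParts lam i
  · rw [if_pos h', if_pos (h.2 h')]
    have hsub : ((lam i : ℤ) + ((j : ℕ) : ℤ) - ((i : ℕ) : ℤ)).toNat =
        shiftedParts lam i - j.rev := by
      rw [shiftedParts, Fin.val_rev] at h' ⊢
      omega
    rw [hsub]
    rfl
  · rw [if_neg h', if_neg (mt h.1 h')]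
    rfl

/-- Multiplying the matrix of the exponents `α` with the matrix of coefficients of the reciprocal
products yields the alternant of `α`. -/
theorem det_hsymm_mul_det_coeff {r : ℕ} (α : Fin r → ℕ) :
    Matrix.det (Matrix.of fun i j : Fin r => if (j.rev : ℕ) ≤ α i then
      MvPolynomial.hsymm (Fin r) ℤ (α i - j.rev) else 0) *
      Matrix.det (Matrix.of fun j l : Fin r => (reciprocalProd r l).coeff j.rev) = alternant α := by
  rw [← Matrix.det_mul, alternant, ← Matrix.det_transpose (Matrix.of fun l i => _)]
  congr 1
  ext1 i l
  simp only [Matrix.transpose_apply, Matrix.mul_apply, Matrix.of_apply]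
  rw [← sum_hsymm_mul_coeff, ← Equiv.sum_comp Fin.revPerm]
  simp only [Fin.revPerm_apply, Fin.rev_rev]

theorem schurSym_zero (r : ℕ) : schurSym r 0 = 1 := by
  rw [schurSym, Matrix.det_of_isUpperTriangular]
  · refine Finset.prod_eq_one fun i _ => ?_
    simp only [Matrix.of_apply, Pi.zero_apply, Nat.cast_zero, zero_add, sub_self, le_refl, if_true,
      Int.toNat_zero]
    exact Subtype.ext (MvPolynomial.hsymm_zero _ _)
  · intro i j hij
    have : (j : ℕ) < i := hij
    rw [Matrix.of_apply, if_neg]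
    simp only [Pi.zero_apply]
    omega

/-- The Vandermonde determinant. -/
noncomputable abbrev vandermondeAlternant (r : ℕ) : MvPolynomial (Fin r) ℤ :=
  alternant (shiftedParts (0 : Fin r → ℕ))

/-- The Jacobi–Trudi identity. -/
theorem schurSym_mul_vandermonde {r : ℕ} (lam : Fin r → ℕ) :
    (schurSym r lam : MvPolynomial (Fin r) ℤ) * vandermondeAlternant r =
      alternant (shiftedParts lam) := by
  -- For the empty partition the matrix of the h's is unitriangular, so the determinant of the
  -- coefficient matrix is the Vandermonde determinant and need not be computed directly.
  have h := det_hsymm_mul_det_coeff (shiftedParts (0 : Fin r → ℕ))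
  rw [← coe_schurSym, schurSym_zero, Subalgebra.coe_one, one_mul] at h
  rw [vandermondeAlternant, ← h, coe_schurSym, det_hsymm_mul_det_coeff]

open MvPolynomial in
/-- The coefficient of an alternant at a strictly decreasing exponent vector. -/
theorem coeff_alternant {r : ℕ} {α β : Fin r → ℕ} (hα : StrictAnti α) (hβ : StrictAnti β) :
    coeff (Finsupp.equivFunOnFinite.symm β) (alternant α) = if α = β then 1 else 0 := by
  have hmono (τ : Equiv.Perm (Fin r)) :
      ∏ i, (X (τ i) : MvPolynomial (Fin r) ℤ) ^ α i =
        monomial (Finsupp.equivFunOnFinite.symm (α ∘ τ.symm)) 1 := by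
    rw [← Equiv.prod_comp τ.symm, monomial_eq, Finsupp.prod_fintype _ _ (by simp)]
    simp
  have hperm (τ : Equiv.Perm (Fin r)) (h : α ∘ τ.symm = β) : τ = 1 := by
    -- τ⁻¹ carries one strictly decreasing vector to another, so it preserves the order, and the
    -- only such permutation is the identity.
    have : StrictMono τ.symm := by
      intro i j hij
      have := hβ hij
      rw [← h] at this
      exact hα.lt_iff_gt.1 this
    have h1 : τ.symm = 1 := by
      ext1 i
      exact congrFun ((this.range_inj strictMono_id).1
        (by rw [τ.symm.surjective.range_eq, Set.range_id])) i
    rw [← Equiv.symm_symm τ, h1]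
    rfl
  rw [alternant, Matrix.det_apply']
  simp only [Matrix.of_apply, hmono]
  rw [coeff_sum, Finset.sum_eq_single 1]
  · simp [coeff_monomial, Equiv.Perm.one_def]
  · intro τ _ hτ
    rw [← map_intCast (C : ℤ →+* MvPolynomial (Fin r) ℤ), coeff_C_mul, coeff_monomial, if_neg,
      mul_zero]
    exact fun h => hτ (hperm τ (Finsupp.equivFunOnFinite.symm.injective h))
  · simp

theorem vandermondeAlternant_ne_zero (r : ℕ) : vandermondeAlternant r ≠ 0 := by
  have h : StrictAnti (shiftedParts (0 : Fin r → ℕ)) := shiftedParts_strictAnti antitone_const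
  intro h0
  have := coeff_alternant h h
  rw [vandermondeAlternant] at h0
  simp [h0] at this

open Finset in
/-- Pieri's rule for Schur polynomials. -/
theorem completeSym_mul_schurSym {r : ℕ} (p : ℕ) {lam : Fin r → ℕ} (hlam : Antitone lam) :
    completeSym r p * schurSym r lam =
      ∑ β ∈ piAntidiag (univ : Finset (Fin r)) p with
        ∀ i j : Fin r, (i : ℕ) + 1 = j → lam j + β j ≤ lam i, schurSym r (lam + β) := by
  classical
  apply Subtype.ext
  apply mul_right_cancel₀ (vandermondeAlternant_ne_zero r)
  rw [MulMemClass.coe_mul, mul_assoc, schurSym_mul_vandermonde, coe_completeSym,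
    hsymm_mul_alternant_eq_sum_strips p (shiftedParts_strictAnti hlam),
    AddSubmonoidClass.coe_finsetSum, Finset.sum_mul]
  simp only [schurSym_mul_vandermonde]
  refine Finset.sum_congr (Finset.filter_congr fun β _ => ?_) fun β _ => ?_
  · simp only [StripViolation, not_exists, not_le, shiftedParts]
    constructor
    · intro h i j hij
      have h1 := h i (by have := j.isLt; omega)
      have h2 : (⟨(i : ℕ) + 1, by have := j.isLt; omega⟩ : Fin r) = j := Fin.ext hij
      rw [h2] at h1
      simp only [Fin.eta] at h1
      omega
    · intro h k hk
      have := h ⟨k, k.lt_succ_self.trans hk⟩ ⟨k + 1, hk⟩ rfl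
      omega
  · congr 1
    funext i
    simp only [shiftedParts, Pi.add_apply]
    omega

/-! ## Linear independence of the Schubert classes -/

/-- The ideal of polynomials all of whose monomials have some exponent `≥ N`. -/
noncomputable def highPowerIdeal (r N : ℕ) : Ideal (MvPolynomial (Fin r) ℤ) :=
  Ideal.span ((fun s => MvPolynomial.monomial s (1 : ℤ)) ''
    Set.range fun i : Fin r => Finsupp.single i N)

theorem coeff_eq_zero_of_mem_highPowerIdeal {r N : ℕ} {f : MvPolynomial (Fin r) ℤ}
    (hf : f ∈ highPowerIdeal r N) {s : Fin r →₀ ℕ} (hs : ∀ i, s i < N) : f.coeff s = 0 := by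
  rw [highPowerIdeal, MvPolynomial.mem_ideal_span_monomial_image] at hf
  by_contra h
  obtain ⟨_, ⟨i, rfl⟩, hi⟩ := hf s (MvPolynomial.mem_support_iff.2 h)
  have := hi i
  rw [Finsupp.single_eq_same] at this
  exact absurd (hs i) (not_lt.2 this)

theorem alternant_mem_highPowerIdeal {r N : ℕ} {α : Fin r → ℕ} {i : Fin r} (h : N ≤ α i) :
    alternant α ∈ highPowerIdeal r N := by
  rw [alternant, Matrix.det_apply']
  refine Ideal.sum_mem _ fun τ _ => Ideal.mul_mem_left _ _ ?_
  rw [← Finset.mul_prod_erase _ _ (Finset.mem_univ i), Matrix.of_apply, ← Nat.add_sub_cancel' h,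
    pow_add, mul_assoc]
  refine Ideal.mul_mem_right _ _ (Ideal.subset_span ⟨_, ⟨τ i, rfl⟩, ?_⟩)
  exact (MvPolynomial.X_pow_eq_monomial).symm

/-- Multiplying a relation h_m by the Vandermonde determinant gives, by Pieri's rule, a single
alternant with first exponent m + r - 1 ≥ N. -/
theorem mul_vandermonde_mem_highPowerIdeal {r N : ℕ} (hr : 1 ≤ r)
    {f : MvPolynomial.symmetricSubalgebra (Fin r) ℤ} (hf : f ∈ grassmannianIdeal r N) :
    (f : MvPolynomial (Fin r) ℤ) * vandermondeAlternant r ∈ highPowerIdeal r N := by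
  classical
  refine Submodule.span_induction (p := fun (f : MvPolynomial.symmetricSubalgebra (Fin r) ℤ) _ =>
    (f : MvPolynomial (Fin r) ℤ) * vandermondeAlternant r ∈ highPowerIdeal r N) ?_ ?_ ?_ ?_ hf
  · rintro _ ⟨m, hm, rfl⟩
    have hanti : StrictAnti (shiftedParts (0 : Fin r → ℕ)) := shiftedParts_strictAnti antitone_const
    rw [coe_completeSym, vandermondeAlternant, hsymm_mul_alternant_eq_sum_strips _ hanti]
    refine Ideal.sum_mem _ fun β hβ => ?_
    simp only [Finset.mem_filter, Finset.mem_piAntidiag] at hβ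
    obtain ⟨⟨hβ, -⟩, hv⟩ := hβ
    refine alternant_mem_highPowerIdeal (i := ⟨0, hr⟩) ?_
    -- Consecutive exponents of the Vandermonde determinant differ by one, which leaves no room for
    -- growth below the first row.
    have h0 : ∀ j : Fin r, j ≠ ⟨0, hr⟩ → β j = 0 := by
      rintro ⟨j, hj⟩ hj0
      obtain _ | j := j
      · exact absurd rfl hj0
      have := hv j
      simp only [StripViolation, not_exists, not_le, shiftedParts] at this
      have := this hj
      simp only [Pi.zero_apply] at this
      omega
    rw [Finset.sum_eq_single ⟨0, hr⟩ (fun j _ hj => h0 j hj) (by simp)] at hβ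
    simp only [Pi.add_apply, shiftedParts, Pi.zero_apply, hβ]
    omega
  · simp
  · intro f g _ _ hf hg
    rw [Subalgebra.coe_add, add_mul]
    exact Ideal.add_mem _ hf hg
  · intro g f _ hf
    rw [smul_eq_mul, Subalgebra.coe_mul, mul_assoc]
    exact Ideal.mul_mem_left _ _ hf

theorem BoxPartition.parts_antitone {r m : ℕ} (μ : BoxPartition r m) : Antitone μ.parts :=
  fun _ _ h => μ.1.rowLen_anti _ _ h

theorem BoxPartition.parts_injective {r m : ℕ} :
    Function.Injective (BoxPartition.parts : BoxPartition r m → Fin r → ℕ) := by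
  intro μ ν h
  apply Subtype.ext
  apply YoungDiagram.ext
  ext ⟨i, c⟩
  have key : ∀ κ : BoxPartition r m, (i, c) ∈ κ.1.cells ↔ ∃ h : i < r, c < κ.parts ⟨i, h⟩ := by
    intro κ
    constructor
    · intro hc
      exact ⟨(κ.2 _ hc).1, YoungDiagram.mem_iff_lt_rowLen.1 hc⟩
    · rintro ⟨_, hc⟩
      exact YoungDiagram.mem_iff_lt_rowLen.2 hc
  rw [key, key, h]

theorem BoxPartition.parts_le {r m : ℕ} (μ : BoxPartition r m) (i : Fin r) : μ.parts i ≤ m := by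
  by_contra h
  have : ((i : ℕ), m) ∈ μ.1.cells := YoungDiagram.mem_iff_lt_rowLen.2 (not_le.1 h)
  exact (μ.2 _ this).2.false

theorem shiftedParts_injective {r : ℕ} :
    Function.Injective (shiftedParts : (Fin r → ℕ) → Fin r → ℕ) := fun _ _ h =>
  funext fun i => Nat.add_right_cancel (congrFun h i)

/-- The Schubert classes of the partitions in the rectangle are linearly independent. -/
theorem linearIndependent_schubertClass {r m : ℕ} (hr : 1 ≤ r) :
    LinearIndependent ℤ fun μ : BoxPartition r m => schubertClass r (m + r) μ.parts := by
  rw [Fintype.linearIndependent_iff]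
  intro c hc ν
  simp only [schubertClass_eq_mk] at hc
  have hmem : ∑ μ : BoxPartition r m, c μ • schurSym r μ.parts ∈ grassmannianIdeal r (m + r) := by
    rw [← Ideal.Quotient.eq_zero_iff_mem, ← hc, map_sum]
    simp only [map_zsmul]
  have h := coeff_eq_zero_of_mem_highPowerIdeal (mul_vandermonde_mem_highPowerIdeal hr hmem)
    -- All exponents are at most m + r - 1, so this coefficient is not affected by the relations; it
    -- isolates `c ν`.
    (s := Finsupp.equivFunOnFinite.symm (shiftedParts ν.parts)) fun i => by
      have := ν.parts_le i
      simp only [Finsupp.equivFunOnFinite_symm_apply_apply, shiftedParts]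
      omega
  rw [AddSubmonoidClass.coe_finsetSum, Finset.sum_mul, MvPolynomial.coeff_sum,
    Finset.sum_eq_single ν] at h
  · rw [Subalgebra.coe_smul, smul_mul_assoc, schurSym_mul_vandermonde, MvPolynomial.coeff_smul,
      coeff_alternant (shiftedParts_strictAnti ν.parts_antitone)
        (shiftedParts_strictAnti ν.parts_antitone)] at h
    simpa using h
  · intro μ _ hμ
    rw [Subalgebra.coe_smul, smul_mul_assoc, schurSym_mul_vandermonde, MvPolynomial.coeff_smul,
      coeff_alternant (shiftedParts_strictAnti μ.parts_antitone)
        (shiftedParts_strictAnti ν.parts_antitone), if_neg, smul_zero]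
    exact fun h => hμ (BoxPartition.parts_injective (shiftedParts_injective h))
  · simp

/-! ## Pieri's rule in terms of column lengths -/

/-- The special Schubert class `σ_p` for a natural number `p`. -/
noncomputable def pieriClass (r N p : ℕ) : GrassmannianCohomology r N :=
  Ideal.Quotient.mk (grassmannianIdeal r N) (completeSym r p)

theorem pieriClass_eq_zero {r N p : ℕ} (h : N < r + p) : pieriClass r N p = 0 :=
  Ideal.Quotient.eq_zero_iff_mem.2 (Ideal.subset_span ⟨p, h, rfl⟩)

theorem schubertClass_zero (r N : ℕ) : schubertClass r N 0 = 1 := by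
  rw [schubertClass_eq_mk, schurSym_zero, map_one]

/-- The indices in the first row of the Giambelli matrix all exceed m, so that row vanishes. -/
theorem schubertClass_eq_zero {r m : ℕ} {lam : Fin r → ℕ} {i : Fin r} (hi : (i : ℕ) = 0)
    (h : m < lam i) : schubertClass r (m + r) lam = 0 := by
  refine Matrix.det_eq_zero_of_row_eq_zero i fun j => ?_
  rw [Matrix.of_apply, specialSchubertClass, if_pos (by omega)]
  exact pieriClass_eq_zero (by omega)

open Finset in
theorem pieriClass_mul_schubertClass {r m : ℕ} (p : ℕ) {lam : Fin r → ℕ} (hlam : Antitone lam) :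
    pieriClass r (m + r) p * schubertClass r (m + r) lam =
      ∑ β ∈ piAntidiag (univ : Finset (Fin r)) p with
        (∀ i j : Fin r, (i : ℕ) + 1 = j → lam j + β j ≤ lam i) ∧
          ∀ i : Fin r, (i : ℕ) = 0 → lam i + β i ≤ m, schubertClass r (m + r) (lam + β) := by
  rw [schubertClass_eq_mk, pieriClass, ← map_mul, completeSym_mul_schurSym p hlam, map_sum,
    ← Finset.filter_filter]
  refine Eq.trans ?_ (Finset.sum_filter_of_ne ?_).symm
  · simp only [schubertClass_eq_mk]
  · intro β _ hβ i hi
    by_contra h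
    exact hβ (schubertClass_eq_zero hi (not_le.1 h))

theorem Fin.lt_card_filter_iff {m : ℕ} {P : Fin m → Prop} [DecidablePred P]
    (hP : ∀ c c', c ≤ c' → P c' → P c) (c : Fin m) :
    (c : ℕ) < (Finset.univ.filter P).card ↔ P c := by
  constructor
  · intro h
    by_contra hc
    have hsub : Finset.univ.filter P ⊆ Finset.Iio c := fun d hd => by
      rw [Finset.mem_filter] at hd
      rw [Finset.mem_Iio]
      by_contra hcd
      exact hc (hP _ _ (not_lt.1 hcd) hd.2)
    have := Finset.card_le_card hsub
    rw [Fin.card_Iio] at this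
    omega
  · intro h
    have hsub : Finset.Iic c ⊆ Finset.univ.filter P := fun d hd => by
      rw [Finset.mem_filter]
      exact ⟨Finset.mem_univ _, hP _ _ (Finset.mem_Iic.1 hd) h⟩
    have := Finset.card_le_card hsub
    rw [Fin.card_Iic] at this
    omega

/-- The row lengths of the diagram with column lengths `g`. -/
def rowsOfCols (r : ℕ) {m : ℕ} (g : Fin m → ℕ) (i : Fin r) : ℕ :=
  (Finset.univ.filter fun c => (i : ℕ) < g c).card

/-- The indicator function of a set of columns. -/
def colIndicator {m : ℕ} (F : Finset (Fin m)) (c : Fin m) : ℕ := if c ∈ F then 1 else 0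

theorem rowsOfCols_antitone (r : ℕ) {m : ℕ} (g : Fin m → ℕ) : Antitone (rowsOfCols r g) :=
  fun _ _ h => Finset.card_le_card (Finset.monotone_filter_right _ fun _ _ hc =>
    lt_of_le_of_lt (by exact h) hc)

theorem lt_rowsOfCols_iff {r m : ℕ} {g : Fin m → ℕ} (hg : Antitone g) (i : Fin r) (c : Fin m) :
    (c : ℕ) < rowsOfCols r g i ↔ (i : ℕ) < g c :=
  Fin.lt_card_filter_iff (P := fun c => (i : ℕ) < g c)
    (fun _ _ h hc => hc.trans_le (hg h)) c

/-- The number of boxes that are added to the row `i` when the columns in `F` are extended. -/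
def rowIncrement (r : ℕ) {m : ℕ} (g : Fin m → ℕ) (F : Finset (Fin m)) (i : Fin r) : ℕ :=
  (F.filter fun c => g c = i).card

/-- With rows counted from 0, the box added at the bottom of column c lies in row g c. -/
theorem rowsOfCols_add_colIndicator (r : ℕ) {m : ℕ} (g : Fin m → ℕ) (F : Finset (Fin m)) :
    rowsOfCols r (g + colIndicator F) = rowsOfCols r g + rowIncrement r g F := by
  funext i
  rw [Pi.add_apply, rowsOfCols, rowsOfCols, rowIncrement, ← Finset.card_union_of_disjoint]
  · congr 1
    ext c
    rw [Finset.mem_union, Finset.mem_filter, Finset.mem_filter, Finset.mem_filter]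
    simp only [Finset.mem_univ, true_and, Pi.add_apply, colIndicator]
    split_ifs with h
    · simp only [h, true_and]
      omega
    · simp [h]
  · rw [Finset.disjoint_left]
    intro c hc hc'
    simp only [Finset.mem_filter] at hc hc'
    omega

/-- The set of columns in which boxes are added when the rows are extended by `β`. -/
def colsOfIncrement {r m : ℕ} (g : Fin m → ℕ) (hr : ∀ c, g c < r) (β : Fin r → ℕ) :
    Finset (Fin m) :=
  Finset.univ.filter fun c => (c : ℕ) < rowsOfCols r g ⟨g c, hr c⟩ + β ⟨g c, hr c⟩

theorem sum_rowIncrement {r m : ℕ} (g : Fin m → ℕ) (hr : ∀ c, g c < r) (F : Finset (Fin m)) :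
    ∑ i, rowIncrement r g F i = F.card := by
  rw [Finset.card_eq_sum_card_fiberwise (f := fun c => (⟨g c, hr c⟩ : Fin r)) (t := Finset.univ)
    (by simp)]
  refine Finset.sum_congr rfl fun i _ => ?_
  simp only [rowIncrement, Fin.ext_iff]

/-- In a horizontal strip the new boxes of row i occupy the columns from the old to the new row
length, and the strip condition says that these columns had length exactly i. -/
theorem rowIncrement_colsOfIncrement {r m : ℕ} {g : Fin m → ℕ} (hg : Antitone g)
    (hr : ∀ c, g c < r) {β : Fin r → ℕ}
    (h1 : ∀ i j : Fin r, (i : ℕ) + 1 = j → rowsOfCols r g j + β j ≤ rowsOfCols r g i)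
    (h0 : ∀ i : Fin r, (i : ℕ) = 0 → rowsOfCols r g i + β i ≤ m) :
    rowIncrement r g (colsOfIncrement g hr β) = β := by
  funext i
  have hle : rowsOfCols r g i + β i ≤ m := by
    obtain ⟨i, hi⟩ := i
    obtain _ | i := i
    · exact h0 _ rfl
    · refine (h1 ⟨i, i.lt_succ_self.trans hi⟩ _ rfl).trans ?_
      exact (Finset.card_le_univ _).trans (by simp)
  have heq : (colsOfIncrement g hr β).filter (fun c => g c = i) =
      Finset.univ.filter fun c : Fin m =>
        rowsOfCols r g i ≤ c ∧ (c : ℕ) < rowsOfCols r g i + β i := by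
    ext c
    simp only [colsOfIncrement, Finset.mem_filter, Finset.mem_univ, true_and]
    constructor
    · rintro ⟨hc, hi⟩
      have hi' : (⟨g c, hr c⟩ : Fin r) = i := Fin.ext hi
      rw [hi'] at hc
      refine ⟨not_lt.1 fun h => ?_, hc⟩
      rw [lt_rowsOfCols_iff hg] at h
      omega
    · rintro ⟨hc, hc'⟩
      have hgi : g c = i := by
        have h2 : ¬ (c : ℕ) < rowsOfCols r g i := not_lt.2 hc
        rw [lt_rowsOfCols_iff hg] at h2
        refine le_antisymm (not_lt.1 h2) ?_
        obtain ⟨i, hi⟩ := i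
        obtain _ | i := i
        · exact Nat.zero_le _
        · have := hc'.trans_le (h1 ⟨i, i.lt_succ_self.trans hi⟩ _ rfl)
          rw [lt_rowsOfCols_iff hg] at this
          exact this
      have hi' : (⟨g c, hr c⟩ : Fin r) = i := Fin.ext hgi
      rw [hi']
      exact ⟨hc', hgi⟩
  rw [rowIncrement, heq, ← Finset.card_map Fin.valEmbedding]
  have : (Finset.univ.filter fun c : Fin m =>
        rowsOfCols r g i ≤ c ∧ (c : ℕ) < rowsOfCols r g i + β i).map Fin.valEmbedding =
      Finset.Ico (rowsOfCols r g i) (rowsOfCols r g i + β i) := by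
    ext x
    simp only [Finset.mem_map, Finset.mem_filter, Finset.mem_univ, true_and,
      Fin.valEmbedding_apply, Finset.mem_Ico]
    constructor
    · rintro ⟨c, hc, rfl⟩
      exact hc
    · intro hx
      exact ⟨⟨x, by omega⟩, hx, rfl⟩
  rw [this, Nat.card_Ico, Nat.add_sub_cancel_left]

open Finset in
open Classical in
/-- Pieri's rule, with partitions given by their column lengths. -/
theorem pieriClass_mul_schubertClass_rowsOfCols {r m : ℕ} (p : ℕ) {g : Fin m → ℕ}
    (hg : Antitone g) (hr : ∀ c, g c < r) :
    pieriClass r (m + r) p * schubertClass r (m + r) (rowsOfCols r g) =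
      ∑ F : Finset (Fin m) with F.card = p ∧ Antitone (g + colIndicator F),
        schubertClass r (m + r) (rowsOfCols r (g + colIndicator F)) := by
  rw [pieriClass_mul_schubertClass p (rowsOfCols_antitone r g)]
  symm
  refine Finset.sum_nbij' (rowIncrement r g) (colsOfIncrement g hr) ?_ ?_ ?_ ?_ ?_
  · intro F hF
    simp only [mem_filter, mem_univ, true_and, mem_piAntidiag, implies_true, and_true] at hF ⊢
    refine ⟨(sum_rowIncrement g hr F).trans hF.1, fun i j hij => ?_, fun i _ => ?_⟩
    · rw [← Pi.add_apply, ← rowsOfCols_add_colIndicator]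
      refine Finset.card_le_card (Finset.monotone_filter_right _ fun c _ hc => ?_)
      simp only [Pi.add_apply, colIndicator] at hc
      split_ifs at hc <;> omega
    · rw [← Pi.add_apply, ← rowsOfCols_add_colIndicator]
      exact (Finset.card_le_univ _).trans (by simp)
  · intro β hβ
    simp only [mem_filter, mem_univ, true_and, mem_piAntidiag, implies_true, and_true] at hβ ⊢
    obtain ⟨hp, h1, h0⟩ := hβ
    refine ⟨?_, fun c c' hc => ?_⟩
    · rw [← sum_rowIncrement g hr, rowIncrement_colsOfIncrement hg hr h1 h0, ← hp]
    · have hgc := hg hc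
      simp only [Pi.add_apply, colIndicator]
      by_cases hgg : g c = g c'
      · have h2 : (⟨g c, hr c⟩ : Fin r) = ⟨g c', hr c'⟩ := Fin.ext hgg
        have h3 : c' ∈ colsOfIncrement g hr β → c ∈ colsOfIncrement g hr β := by
          simp only [colsOfIncrement, mem_filter, mem_univ, true_and, h2]
          exact fun h => lt_of_le_of_lt (by exact hc) h
        split_ifs with h4 h5 <;> first | omega | exact absurd (h3 h4) h5
      · split_ifs <;> omega
  · intro F hF
    simp only [mem_filter, mem_univ, true_and] at hF
    ext c
    simp only [colsOfIncrement, mem_filter, mem_univ, true_and]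
    rw [← Pi.add_apply (rowsOfCols r g), ← rowsOfCols_add_colIndicator, lt_rowsOfCols_iff hF.2]
    by_cases hc : c ∈ F <;> simp [colIndicator, hc]
  · intro β hβ
    simp only [mem_filter] at hβ
    exact rowIncrement_colsOfIncrement hg hr hβ.2.1 hβ.2.2
  · intro F _
    rw [rowsOfCols_add_colIndicator]

/-- The number of sets `E_i`, `i < t`, that contain a given column. -/
def colSums {k m : ℕ} (E : Fin k → Finset (Fin m)) (t : ℕ) (c : Fin m) : ℕ :=
  (Finset.univ.filter fun i : Fin k => (i : ℕ) < t ∧ c ∈ E i).card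

theorem colSums_eq_sum {k m : ℕ} (E : Fin k → Finset (Fin m)) (t : ℕ) (c : Fin m) :
    colSums E t c = ∑ i : Fin k, if (i : ℕ) < t then colIndicator (E i) c else 0 := by
  simp only [colSums, Finset.card_filter, colIndicator, ← ite_and]

theorem colSums_zero {k m : ℕ} (E : Fin k → Finset (Fin m)) : colSums E 0 = 0 := by
  funext c
  simp [colSums_eq_sum]

theorem colSums_le {k m : ℕ} (E : Fin k → Finset (Fin m)) (t : ℕ) (c : Fin m) :
    colSums E t c ≤ k :=
  (Finset.card_le_univ _).trans (by simp)

theorem colSums_succ {k m : ℕ} (E : Fin k → Finset (Fin m)) (i : Fin k) :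
    colSums E (i + 1) = colSums E i + colIndicator (E i) := by
  funext c
  simp only [Pi.add_apply, colSums_eq_sum]
  rw [← Finset.add_sum_erase _ _ (Finset.mem_univ i),
    ← Finset.add_sum_erase _ (fun j : Fin k => if (j : ℕ) < i then _ else 0) (Finset.mem_univ i),
    if_pos (Nat.lt_succ_self _), if_neg (lt_irrefl _), zero_add, add_comm]
  congr 1
  refine Finset.sum_congr rfl fun j hj => ?_
  have : (j : ℕ) ≠ i := fun h => Finset.ne_of_mem_erase hj (Fin.ext h)
  simp only [show (j : ℕ) < i + 1 ↔ (j : ℕ) < i by omega]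

theorem colSums_of_le {k m : ℕ} (E : Fin k → Finset (Fin m)) {t : ℕ} (ht : k ≤ t) :
    colSums E t = colSums E k := by
  funext c
  simp only [colSums_eq_sum]
  exact Finset.sum_congr rfl fun i _ => by rw [if_pos (i.isLt.trans_le ht), if_pos i.isLt]

theorem colSums_snoc_of_le {k m : ℕ} (E : Fin k → Finset (Fin m)) (F : Finset (Fin m)) {t : ℕ}
    (ht : t ≤ k) : colSums (Fin.snoc E F : Fin (k + 1) → Finset (Fin m)) t = colSums E t := by
  funext c
  simp [colSums_eq_sum, Fin.sum_univ_castSucc, not_lt.2 ht]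

theorem colSums_snoc_succ {k m : ℕ} (E : Fin k → Finset (Fin m)) (F : Finset (Fin m)) :
    colSums (Fin.snoc E F : Fin (k + 1) → Finset (Fin m)) (k + 1) =
      colSums E k + colIndicator F := by
  have := colSums_succ (Fin.snoc E F : Fin (k + 1) → Finset (Fin m)) (Fin.last k)
  rw [Fin.snoc_last, Fin.val_last, colSums_snoc_of_le _ _ le_rfl] at this
  exact this

open Finset in
open Classical in
/-- The iterated rule of Pieri. -/
theorem prod_pieriClass {r m : ℕ} : ∀ (k : ℕ) (_ : k ≤ r) (q : Fin k → ℕ),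
    ∏ i, pieriClass r (m + r) (q i) =
      ∑ E : Fin k → Finset (Fin m) with (∀ i, (E i).card = q i) ∧ ∀ t, Antitone (colSums E t),
        schubertClass r (m + r) (rowsOfCols r (colSums E k))
  | 0, _, q => by
    have h : ∀ E : Fin 0 → Finset (Fin m), ∀ t, colSums E t = 0 := fun E t => by
      funext c
      simp [colSums_eq_sum]
    have h0 : rowsOfCols r (0 : Fin m → ℕ) = 0 := by
      funext i
      simp [rowsOfCols]
    simp only [h, h0, schubertClass_zero]
    rw [Finset.filter_true_of_mem fun E _ => ⟨fun i => i.elim0, fun _ => antitone_const⟩]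
    simp
  | k + 1, hk, q => by
    rw [Fin.prod_univ_castSucc, prod_pieriClass k (by omega), Finset.sum_mul, Finset.sum_filter,
      Finset.sum_filter, ← (Fin.snocEquiv fun _ => Finset (Fin m)).sum_comp,
      Fintype.sum_prod_type_right]
    refine Finset.sum_congr rfl fun E _ => ?_
    have hiff : ∀ F : Finset (Fin m),
        ((∀ i, ((Fin.snoc E F : Fin (k + 1) → Finset (Fin m)) i).card = q i) ∧
          ∀ t, Antitone (colSums (Fin.snoc E F : Fin (k + 1) → Finset (Fin m)) t)) ↔
        ((∀ i, (E i).card = q i.castSucc) ∧ ∀ t, Antitone (colSums E t)) ∧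
          F.card = q (Fin.last k) ∧ Antitone (colSums E k + colIndicator F) := by
      intro F
      constructor
      · rintro ⟨h1, h2⟩
        refine ⟨⟨fun i => ?_, fun t => ?_⟩, ?_, ?_⟩
        · simpa using h1 i.castSucc
        · rcases le_total t k with ht | ht
          · rw [← colSums_snoc_of_le E F ht]
            exact h2 t
          · rw [colSums_of_le E ht, ← colSums_snoc_of_le E F le_rfl]
            exact h2 k
        · simpa using h1 (Fin.last k)
        · rw [← colSums_snoc_succ]
          exact h2 _
      · rintro ⟨⟨h1, h2⟩, h3, h4⟩
        refine ⟨fun i => ?_, fun t => ?_⟩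
        · refine Fin.lastCases ?_ (fun i => ?_) i
          · simpa using h3
          · simpa using h1 i
        · rcases Nat.lt_or_ge k t with ht | ht
          · rw [colSums_of_le _ ht, colSums_snoc_succ]
            exact h4
          · rw [colSums_snoc_of_le E F ht]
            exact h2 t
    have hsnoc : ∀ F, (Fin.snocEquiv fun _ => Finset (Fin m)) (F, E) =
        (Fin.snoc E F : Fin (k + 1) → Finset (Fin m)) := fun _ => rfl
    simp only [hsnoc, hiff, colSums_snoc_succ]
    split_ifs with h
    · refine (mul_comm (G := GrassmannianCohomology r (m + r)) _ _).trans ?_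
      rw [pieriClass_mul_schubertClass_rowsOfCols _ (h.2 k)
        -- After k steps columns have length at most k < r, so each can still receive a box.
        fun c => (colSums_le E k c).trans_lt (by omega), Finset.sum_filter]
      simp only [h, implies_true, and_self, true_and]
    · simp only [h, false_and, if_false, Finset.sum_const_zero]

/-! ## The Schubert classes of rectangles with one further part -/

/-- The only set of m columns is the set of all columns, so Pieri's sum has one term. -/
theorem pieriClass_mul_schubertClass_full {r m : ℕ} {g : Fin m → ℕ} (hg : Antitone g)
    (hr : ∀ c, g c < r) :
    pieriClass r (m + r) m * schubertClass r (m + r) (rowsOfCols r g) =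
      schubertClass r (m + r) (rowsOfCols r (fun c => g c + 1)) := by
  classical
  rw [pieriClass_mul_schubertClass_rowsOfCols m hg hr]
  have hu : g + colIndicator Finset.univ = fun c => g c + 1 := by
    funext c
    simp [colIndicator]
  rw [← hu]
  refine (Finset.sum_eq_single Finset.univ ?_ ?_)
  · intro F hF hF'
    simp only [Finset.mem_filter, Finset.mem_univ, true_and] at hF
    exact absurd ((Finset.card_eq_iff_eq_univ F).1 (by simpa using hF.1)) hF'
  · intro h
    refine absurd ?_ h
    simp only [Finset.mem_filter, Finset.mem_univ, true_and, Finset.card_univ, Fintype.card_fin, hu]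
    exact fun c c' hc => Nat.add_le_add_right (hg hc) 1

/-- The column lengths of the partition with `k` parts `m` and one part `p`. -/
def rectangleCols (m k p : ℕ) (c : Fin m) : ℕ := k + if (c : ℕ) < p then 1 else 0

theorem rectangleCols_antitone (m k p : ℕ) : Antitone (rectangleCols m k p) := by
  intro c c' hc
  have : (c : ℕ) ≤ c' := hc
  simp only [rectangleCols]
  split_ifs <;> omega

theorem rowsOfCols_rectangleCols {r m k p : ℕ} (hp : p ≤ m) :
    rowsOfCols r (rectangleCols m k p) = rectanglePlusPart r m k p := by
  funext i
  rw [rowsOfCols, rectanglePlusPart]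
  split_ifs with h1 h2
  · rw [Finset.filter_true_of_mem fun c _ => by rw [rectangleCols]; omega]
    simp
  · have : (Finset.univ.filter fun c : Fin m => (i : ℕ) < rectangleCols m k p c) =
        Finset.univ.filter fun c : Fin m => (c : ℕ) < p :=
      Finset.filter_congr fun c _ => by rw [rectangleCols]; split_ifs <;> omega
    rw [this, Fin.card_filter_val_lt, min_eq_right hp]
  · rw [Finset.filter_false_of_mem fun c _ => by rw [rectangleCols]; split_ifs <;> omega]
    simp

/-- Each factor σ_m adds a full row. For k = 0, a set of p columns with weakly decreasing indicator
must consist of the first p columns. -/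
theorem schubertClass_rectanglePlusPart {r m p : ℕ} (hp : p ≤ m) : ∀ {k : ℕ} (_ : k < r),
    schubertClass r (m + r) (rectanglePlusPart r m k p) =
      pieriClass r (m + r) m ^ k * pieriClass r (m + r) p
  | 0, hr => by
    classical
    have h0 : rowsOfCols r (0 : Fin m → ℕ) = 0 := by
      funext i
      simp [rowsOfCols]
    have h := pieriClass_mul_schubertClass_rowsOfCols (r := r) (m := m) p (g := 0) antitone_const
      fun _ => hr
    rw [h0, schubertClass_zero, mul_one] at h
    have hcard : (Finset.univ.filter fun c : Fin m => (c : ℕ) < p).card = p := by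
      rw [Fin.card_filter_val_lt, min_eq_right hp]
    have hind : 0 + colIndicator (Finset.univ.filter fun c : Fin m => (c : ℕ) < p) =
        rectangleCols m 0 p := by
      funext c
      simp [colIndicator, rectangleCols]
    rw [pow_zero, one_mul, h,
      Finset.sum_eq_single (Finset.univ.filter fun c : Fin m => (c : ℕ) < p),
      hind, rowsOfCols_rectangleCols hp]
    · intro F hF hF'
      simp only [Finset.mem_filter, Finset.mem_univ, true_and, zero_add] at hF
      refine absurd ?_ hF'
      ext c
      have := Fin.lt_card_filter_iff (P := fun c => c ∈ F) (fun c c' hc hc' => by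
        by_contra h
        have := hF.2 hc
        simp [colIndicator, hc', h] at this) c
      rw [Finset.filter_mem_eq_inter, Finset.univ_inter, hF.1] at this
      simp [this]
    · intro h
      refine absurd ?_ h
      simp only [Finset.mem_filter, Finset.mem_univ, true_and]
      exact ⟨hcard, hind ▸ rectangleCols_antitone m 0 p⟩
  | k + 1, hk => by
    rw [pow_succ', mul_assoc, ← schubertClass_rectanglePlusPart hp (k.lt_succ_self.trans hk),
      ← rowsOfCols_rectangleCols hp, ← rowsOfCols_rectangleCols hp,
      pieriClass_mul_schubertClass_full (rectangleCols_antitone m k p)]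
    · congr 2
      funext c
      simp only [rectangleCols]
      omega
    · intro c
      simp only [rectangleCols]
      split_ifs <;> omega

/-! ## Semistandard tableaux as sequences of sets of columns -/

theorem Nat.lt_card_iff_mem {S : Finset ℕ} (hS : ∀ x ∈ S, ∀ y, y ≤ x → y ∈ S) (x : ℕ) :
    x < S.card ↔ x ∈ S := by
  constructor
  · intro h
    by_contra hx
    have hsub : S ⊆ Finset.range x := fun y hy => by
      rw [Finset.mem_range]
      by_contra hxy
      exact hx (hS y hy x (not_lt.1 hxy))
    have := Finset.card_le_card hsub
    rw [Finset.card_range] at this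
    omega
  · intro h
    have hsub : Finset.range (x + 1) ⊆ S := fun y hy =>
      hS x h y (Nat.lt_succ_iff.1 (Finset.mem_range.1 hy))
    have := Finset.card_le_card hsub
    rw [Finset.card_range] at this
    omega

theorem colSums_mono {k m : ℕ} (E : Fin k → Finset (Fin m)) (c : Fin m) :
    Monotone fun t => colSums E t c := fun _ _ h =>
  Finset.card_le_card (Finset.monotone_filter_right _ fun _ _ hc => ⟨hc.1.trans_le h, hc.2⟩)

theorem colSums_succ_le {k m : ℕ} (E : Fin k → Finset (Fin m)) (t : ℕ) (c : Fin m) :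
    colSums E (t + 1) c ≤ colSums E t c + 1 := by
  rcases Nat.lt_or_ge t k with h | h
  · have := congrFun (colSums_succ E ⟨t, h⟩) c
    simp only [Pi.add_apply, colIndicator] at this
    rw [this]
    split_ifs <;> omega
  · rw [colSums_of_le E h, colSums_of_le E (h.trans t.le_succ)]
    omega

theorem mem_iff_colSums_lt {k m : ℕ} (E : Fin k → Finset (Fin m)) (i : Fin k) (c : Fin m) :
    c ∈ E i ↔ colSums E i c < colSums E (i + 1) c := by
  rw [colSums_succ, Pi.add_apply, colIndicator]
  split_ifs with h <;> simp [h]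

section Tableau

variable {μ : YoungDiagram}

open Classical in
/-- The columns of a tableau that contain the entry `i`. -/
noncomputable def tableauCols (T : SemistandardYoungTableau μ) (m i : ℕ) : Finset (Fin m) :=
  Finset.univ.filter fun c => ∃ x, (x, (c : ℕ)) ∈ μ ∧ T x c = i

theorem mem_tableauCols {T : SemistandardYoungTableau μ} {m i : ℕ} {c : Fin m} :
    c ∈ tableauCols T m i ↔ ∃ x, (x, (c : ℕ)) ∈ μ ∧ T x c = i := by
  simp [tableauCols]

/-- The sets of columns that contain the entries `1, …, r`. -/
noncomputable def tableauColSets (T : SemistandardYoungTableau μ) (m r : ℕ) (i : Fin r) :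
    Finset (Fin m) :=
  tableauCols T m (i + 1)

theorem SemistandardYoungTableau.eq_of_apply_eq (T : SemistandardYoungTableau μ) {x y c : ℕ}
    (hx : (x, c) ∈ μ) (hy : (y, c) ∈ μ) (h : T x c = T y c) : x = y := by
  rcases lt_trichotomy x y with hxy | hxy | hxy
  · exact absurd h (T.col_strict hxy hy).ne
  · exact hxy
  · exact absurd h (T.col_strict hxy hx).ne'

/-- The entries ≤ t fill a top segment of each column and are distinct there, so the segment's
length is the number of values ≤ t that occur. All passages between tableaux and column sets rest on
this. -/
theorem lt_colSums_tableauColSets_iff {T : SemistandardYoungTableau μ} {r : ℕ}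
    (hT : ∀ c ∈ μ.cells, 1 ≤ T c.1 c.2 ∧ T c.1 c.2 ≤ r) {m : ℕ} (t : ℕ) (c : Fin m) (x : ℕ) :
    x < colSums (tableauColSets T m r) t c ↔ (x, (c : ℕ)) ∈ μ ∧ T x c ≤ t := by
  have hcard : ((Finset.range (μ.colLen c)).filter fun x => T x c ≤ t).card =
      colSums (tableauColSets T m r) t c := by
    have hmem : ∀ x ∈ (Finset.range (μ.colLen c)).filter fun x => T x c ≤ t,
        (x, (c : ℕ)) ∈ μ ∧ 1 ≤ T x c ∧ T x c ≤ r ∧ T x c ≤ t := fun x hx => by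
      rw [Finset.mem_filter, Finset.mem_range, ← YoungDiagram.mem_iff_lt_colLen] at hx
      have := hT _ ((YoungDiagram.mem_cells _).2 hx.1)
      exact ⟨hx.1, this.1, this.2, hx.2⟩
    refine Finset.card_bij (fun x hx => ⟨T x c - 1, by have := hmem x hx; omega⟩) ?_ ?_ ?_
    · intro x hx
      have hx' := hmem x hx
      refine Finset.mem_filter.2 ⟨Finset.mem_univ _, ?_⟩
      rw [tableauColSets, mem_tableauCols]
      exact ⟨by simp only; omega, x, hx'.1, by simp only; omega⟩
    · intro x hx y hy hxy
      have hx' := hmem x hx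
      have hy' := hmem y hy
      simp only [Fin.mk.injEq] at hxy
      exact T.eq_of_apply_eq hx'.1 hy'.1 (by omega)
    · intro i hi
      replace hi := (Finset.mem_filter.1 hi).2
      rw [tableauColSets, mem_tableauCols] at hi
      obtain ⟨hit, x, hx, hxi⟩ := hi
      refine ⟨x, ?_, ?_⟩
      · rw [Finset.mem_filter, Finset.mem_range, ← YoungDiagram.mem_iff_lt_colLen]
        exact ⟨hx, by omega⟩
      · apply Fin.ext
        simp only
        omega
  rw [← hcard, Nat.lt_card_iff_mem, Finset.mem_filter, Finset.mem_range,
    ← YoungDiagram.mem_iff_lt_colLen]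
  intro x hx y hy
  rw [Finset.mem_filter, Finset.mem_range, ← YoungDiagram.mem_iff_lt_colLen] at hx ⊢
  exact ⟨μ.up_left_mem hy le_rfl hx.1, (T.col_weak hy hx.1).trans hx.2⟩

theorem colSums_tableauColSets_antitone {T : SemistandardYoungTableau μ} {r : ℕ}
    (hT : ∀ c ∈ μ.cells, 1 ≤ T c.1 c.2 ∧ T c.1 c.2 ≤ r) (m t : ℕ) :
    Antitone (colSums (tableauColSets T m r) t) := by
  intro c c' hc
  refine le_of_forall_lt fun x hx => ?_
  rw [lt_colSums_tableauColSets_iff hT] at hx ⊢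
  exact ⟨μ.up_left_mem le_rfl hc hx.1, (T.row_weak_of_le hc hx.1).trans hx.2⟩

theorem colSums_tableauColSets_eq_colLen {T : SemistandardYoungTableau μ} {r : ℕ}
    (hT : ∀ c ∈ μ.cells, 1 ≤ T c.1 c.2 ∧ T c.1 c.2 ≤ r) {m : ℕ} (c : Fin m) :
    colSums (tableauColSets T m r) r c = μ.colLen c := by
  refine eq_of_forall_lt_iff fun x => ?_
  rw [lt_colSums_tableauColSets_iff hT, ← YoungDiagram.mem_iff_lt_colLen, and_iff_left_iff_imp]
  exact fun h => (hT _ ((YoungDiagram.mem_cells _).2 h)).2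

theorem tableauWeight_eq_card {T : SemistandardYoungTableau μ} {m : ℕ}
    (hm : ∀ c ∈ μ.cells, c.2 < m) (i : ℕ) : tableauWeight T i = (tableauCols T m i).card := by
  have hmem : ∀ b ∈ μ.cells.filter fun c => T c.1 c.2 = i, b ∈ μ ∧ T b.1 b.2 = i := fun b hb => by
    rw [Finset.mem_filter, YoungDiagram.mem_cells] at hb
    exact hb
  refine Finset.card_bij (fun b hb => ⟨b.2, hm b (Finset.mem_of_mem_filter b hb)⟩) ?_ ?_ ?_
  · intro b hb
    exact mem_tableauCols.2 ⟨b.1, hmem b hb⟩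
  · rintro ⟨x, c⟩ hb ⟨y, c'⟩ hb' h
    obtain rfl : c = c' := Fin.mk.inj h
    have h1 := hmem _ hb
    have h2 := hmem _ hb'
    rw [T.eq_of_apply_eq h1.1 h2.1 (h1.2.trans h2.2.symm)]
  · intro c hc
    obtain ⟨x, hx⟩ := mem_tableauCols.1 hc
    exact ⟨(x, c), Finset.mem_filter.2 hx, rfl⟩

theorem IsStrip.exists_mem {m : ℕ} {S : Finset (ℕ × ℕ)} (hm : ∀ c ∈ μ.cells, c.2 < m)
    (hS : IsStrip m μ S) (c : Fin m) : ∃ x, (x, (c : ℕ)) ∈ S := by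
  obtain ⟨hsub, hcard, hinj, -⟩ := hS
  have h1 : S.image Prod.snd ⊆ Finset.range m := by
    intro c hc
    obtain ⟨b, hb, rfl⟩ := Finset.mem_image.1 hc
    exact Finset.mem_range.2 (hm b (hsub hb))
  have h2 : (S.image Prod.snd).card = m := by
    rw [Finset.card_image_of_injOn, hcard]
    intro b hb b' hb' h
    by_contra hne
    exact hinj b hb b' hb' hne h
  have h3 := Finset.eq_of_subset_of_card_le h1 (by rw [h2, Finset.card_range])
  have h4 : (c : ℕ) ∈ S.image Prod.snd := by
    rw [h3]
    exact Finset.mem_range.2 c.isLt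
  obtain ⟨⟨x, c'⟩, hb, h⟩ := Finset.mem_image.1 h4
  exact ⟨x, by simpa [← h] using hb⟩

/-- A strip has exactly one box in each of the m columns: it must use i where i + 1 is missing and i
+ 1 where i is missing, which forces the ordering. Conversely, use i on the longest initial run of
columns containing i, and i + 1 afterwards. -/
theorem exists_isConsecutiveStrip_iff {T : SemistandardYoungTableau μ} {m : ℕ}
    (hm : ∀ c ∈ μ.cells, c.2 < m) (i : ℕ) :
    (∃ S, IsConsecutiveStrip m T i S) ↔
      ∀ x, x ∉ tableauCols T m (i + 1) → ∀ y, y ∉ tableauCols T m i → x < y := by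
  classical
  constructor
  · rintro ⟨S, hS, hval, hlt⟩ c hc c' hc'
    obtain ⟨x, hx⟩ := hS.exists_mem hm c
    obtain ⟨y, hy⟩ := hS.exists_mem hm c'
    have hx1 : T x c = i := (hval _ hx).resolve_right fun h =>
      hc (mem_tableauCols.2 ⟨x, hS.1 hx, h⟩)
    have hy1 : T y c' = i + 1 := (hval _ hy).resolve_left fun h =>
      hc' (mem_tableauCols.2 ⟨y, hS.1 hy, h⟩)
    exact hlt _ hx _ hy hx1 hy1
  · intro h
    have hex : ∀ c : Fin m, ∃ x, (x, (c : ℕ)) ∈ μ ∧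
        T x c = if ∀ c' ≤ c, c' ∈ tableauCols T m i then i else i + 1 := by
      intro c
      split_ifs with hc
      · exact mem_tableauCols.1 (hc c le_rfl)
      · push Not at hc
        obtain ⟨y, hyc, hy⟩ := hc
        by_contra hn
        exact absurd (h c (fun hc => hn (mem_tableauCols.1 hc)) y hy) (not_lt.2 hyc)
    choose f hf hTf using hex
    have hcases : ∀ c, T (f c) c = i ∨ T (f c) c = i + 1 := fun c => by
      rw [hTf]
      split_ifs <;> simp
    have hord : ∀ c c' : Fin m, T (f c) c = i → T (f c') c' = i + 1 → c < c' := by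
      intro c c' h1 h2
      rw [hTf] at h1 h2
      split_ifs at h1 with h3
      · split_ifs at h2 with h4
        · omega
        · by_contra hcc
          exact h4 fun d hd => h3 d (hd.trans (not_lt.1 hcc))
      · omega
    have hinj : Function.Injective fun c : Fin m => (f c, (c : ℕ)) := fun c c' h =>
      Fin.ext (congrArg Prod.snd h)
    refine ⟨Finset.univ.image fun c => (f c, (c : ℕ)), ⟨?_, ?_, ?_, ?_⟩, ?_, ?_⟩
    · intro b hb
      obtain ⟨c, -, rfl⟩ := Finset.mem_image.1 hb
      exact hf c
    · rw [Finset.card_image_of_injective _ hinj, Finset.card_univ, Fintype.card_fin]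
    · intro b hb b' hb' hne heq
      obtain ⟨c, -, rfl⟩ := Finset.mem_image.1 hb
      obtain ⟨c', -, rfl⟩ := Finset.mem_image.1 hb'
      exact hne (by rw [Fin.ext heq])
    · intro b hb b' hb' hlt hrow
      obtain ⟨c, -, rfl⟩ := Finset.mem_image.1 hb
      obtain ⟨c', -, rfl⟩ := Finset.mem_image.1 hb'
      simp only at hlt hrow
      have h1 : T (f c') c ≤ T (f c') c' := T.row_weak hlt (hf c')
      have h2 : T (f c) c < T (f c') c :=
        T.col_strict hrow (μ.up_left_mem le_rfl hlt.le (hf c'))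
      rcases hcases c with hc | hc <;> rcases hcases c' with hc' | hc'
      · omega
      -- The run of i's ends at some column y without i, with c < y ≤ c'. If the box in column c
      -- were above the one in column c', semistandardness would force the entry i in column y, in
      -- the row of the former box.
      · have h3 : ¬ ∀ d ≤ c', d ∈ tableauCols T m i := fun hd => by
          have := hTf c'
          rw [if_pos hd] at this
          omega
        push Not at h3
        obtain ⟨y, hyc', hy⟩ := h3
        have hcy : (c : ℕ) < y := by
          by_contra hyc
          have h4 : ∀ d ≤ c, d ∈ tableauCols T m i := by
            by_contra hn
            have := hTf c
            rw [if_neg hn] at this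
            omega
          exact hy (h4 y (not_lt.1 hyc))
        have hmem : (f c', (y : ℕ)) ∈ μ := μ.up_left_mem le_rfl hyc' (hf c')
        have hmem' : (f c, (y : ℕ)) ∈ μ := μ.up_left_mem hrow.le le_rfl hmem
        have h5 := T.row_weak_of_le hyc' (hf c')
        have h6 := T.row_weak hcy hmem'
        have h7 := T.col_strict hrow hmem
        exact hy (mem_tableauCols.2 ⟨f c, hmem', by omega⟩)
      · exact absurd hlt (not_lt.2 (hord c' c hc' hc).le)
      · omega
    · intro b hb
      obtain ⟨c, -, rfl⟩ := Finset.mem_image.1 hb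
      exact hcases c
    · intro b hb b' hb' h1 h2
      obtain ⟨c, -, rfl⟩ := Finset.mem_image.1 hb
      obtain ⟨c', -, rfl⟩ := Finset.mem_image.1 hb'
      exact hord c c' h1 h2

theorem tableauColSets_injective {T T' : SemistandardYoungTableau μ} {m r : ℕ}
    (hm : ∀ c ∈ μ.cells, c.2 < m)
    (hT : ∀ c ∈ μ.cells, 1 ≤ T c.1 c.2 ∧ T c.1 c.2 ≤ r)
    (hT' : ∀ c ∈ μ.cells, 1 ≤ T' c.1 c.2 ∧ T' c.1 c.2 ≤ r)
    (h : tableauColSets T m r = tableauColSets T' m r) : T = T' := by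
  ext x c
  by_cases hc : (x, c) ∈ μ
  · refine eq_of_forall_ge_iff fun t => ?_
    have h1 := lt_colSums_tableauColSets_iff hT t ⟨c, hm _ hc⟩ x
    rw [h, lt_colSums_tableauColSets_iff hT'] at h1
    simpa [hc] using h1.symm
  · rw [T.zeros hc, T'.zeros hc]

section OfCols

variable {r m : ℕ} {E : Fin r → Finset (Fin m)}

/-- The entries of the tableau with given sets of columns. -/
noncomputable def entryOfCols (μ : YoungDiagram) (E : Fin r → Finset (Fin m)) (x c : ℕ) : ℕ :=
  open Classical in
  if h : c < m ∧ (x, c) ∈ μ then sInf {t | x < colSums E t ⟨c, h.1⟩} else 0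

theorem entryOfCols_le_iff (hμ : ∀ c : Fin m, colSums E r c = μ.colLen c) {x : ℕ} {c : Fin m}
    (hc : (x, (c : ℕ)) ∈ μ) (t : ℕ) : entryOfCols μ E x c ≤ t ↔ x < colSums E t c := by
  have hne : {t | x < colSums E t c}.Nonempty :=
    ⟨r, by rw [Set.mem_ofPred_eq, hμ]; exact YoungDiagram.mem_iff_lt_colLen.1 hc⟩
  rw [entryOfCols, dif_pos ⟨c.isLt, hc⟩]
  constructor
  · intro h
    exact lt_of_lt_of_le (b := colSums E (sInf {t | x < colSums E t c}) c) (Nat.sInf_mem hne)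
      (colSums_mono E c h)
  · exact fun h => Nat.sInf_le h

theorem entryOfCols_eq_succ_iff (hμ : ∀ c : Fin m, colSums E r c = μ.colLen c) {x : ℕ}
    {c : Fin m} (hc : (x, (c : ℕ)) ∈ μ) (t : ℕ) :
    entryOfCols μ E x c = t + 1 ↔ colSums E t c ≤ x ∧ x < colSums E (t + 1) c := by
  rw [← entryOfCols_le_iff hμ hc, ← not_lt, ← entryOfCols_le_iff hμ hc]
  omega

/-- The tableau with given sets of columns. -/
noncomputable def tableauOfCols (hm : ∀ c ∈ μ.cells, c.2 < m)
    (hμ : ∀ c : Fin m, colSums E r c = μ.colLen c) (hE : ∀ t, Antitone (colSums E t)) :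
    SemistandardYoungTableau μ where
  entry := entryOfCols μ E
  row_weak' := by
    intro x c c' hcc hc'
    have hc := μ.up_left_mem le_rfl hcc.le hc'
    have h1 := (entryOfCols_le_iff (c := ⟨c', hm _ hc'⟩) hμ hc' _).1 le_rfl
    exact (entryOfCols_le_iff (c := ⟨c, hm _ hc⟩) hμ hc _).2
      (h1.trans_le (hE _ (by exact hcc.le)))
  col_strict' := by
    intro x x' c hxx hc'
    have hc := μ.up_left_mem hxx.le le_rfl hc'
    by_contra hn
    have h1 := (entryOfCols_le_iff (c := ⟨c, hm _ hc'⟩) hμ hc' _).1 (not_lt.1 hn)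
    have h2 := entryOfCols_le_iff (c := ⟨c, hm _ hc⟩) hμ hc
    simp only at h1 h2
    rcases h3 : entryOfCols μ E x c with _ | t
    · rw [h3, colSums_zero] at h1
      exact absurd h1 (Nat.not_lt_zero _)
    · rw [h3] at h1
      -- A column grows by at most one box per step, so a lower box cannot appear at the same step
      -- as a higher one.
      have h4 := colSums_succ_le E t ⟨c, hm _ hc⟩
      have h5 := (h2 t).2 (by omega)
      omega
  zeros' := by
    intro x c hc
    rw [entryOfCols, dif_neg fun h => hc h.2]

theorem tableauOfCols_apply (hm : ∀ c ∈ μ.cells, c.2 < m)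
    (hμ : ∀ c : Fin m, colSums E r c = μ.colLen c) (hE : ∀ t, Antitone (colSums E t)) (x c : ℕ) :
    tableauOfCols hm hμ hE x c = entryOfCols μ E x c :=
  rfl

theorem tableauOfCols_mem_range (hm : ∀ c ∈ μ.cells, c.2 < m)
    (hμ : ∀ c : Fin m, colSums E r c = μ.colLen c) (hE : ∀ t, Antitone (colSums E t))
    (b : ℕ × ℕ) (hb : b ∈ μ.cells) :
    1 ≤ tableauOfCols hm hμ hE b.1 b.2 ∧ tableauOfCols hm hμ hE b.1 b.2 ≤ r := by
  have h := entryOfCols_le_iff (x := b.1) (c := ⟨b.2, hm b hb⟩) hμ hb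
  rw [tableauOfCols_apply]
  constructor
  · by_contra hn
    have := (h 0).1 (by simp only; omega)
    rw [colSums_zero] at this
    exact absurd this (Nat.not_lt_zero _)
  · refine (h r).2 ?_
    rw [hμ]
    exact YoungDiagram.mem_iff_lt_colLen.1 hb

theorem tableauColSets_tableauOfCols (hm : ∀ c ∈ μ.cells, c.2 < m)
    (hμ : ∀ c : Fin m, colSums E r c = μ.colLen c) (hE : ∀ t, Antitone (colSums E t)) :
    tableauColSets (tableauOfCols hm hμ hE) m r = E := by
  funext i
  ext c
  rw [tableauColSets, mem_tableauCols, mem_iff_colSums_lt]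
  simp only [tableauOfCols_apply]
  constructor
  · rintro ⟨x, hx, h⟩
    rw [entryOfCols_eq_succ_iff hμ hx] at h
    exact h.1.trans_lt h.2
  · intro h
    have hx : (colSums E i c, (c : ℕ)) ∈ μ := by
      rw [YoungDiagram.mem_iff_lt_colLen, ← hμ]
      exact h.trans_le (colSums_mono E c i.isLt)
    exact ⟨_, hx, (entryOfCols_eq_succ_iff hμ hx _).2 ⟨le_rfl, h⟩⟩

end OfCols

end Tableau

/-- Sequences of sets of columns that are obtained from tableaux: the set of columns without the
entry `i + 1` has `d i` elements, and for `j ∈ B` the columns without the entry `j + 1` lie to the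
left of the columns without the entry `j`. -/
def IsColSequence {r m : ℕ} (d : Fin r → ℕ) (B : ℕ → Prop) (E : Fin r → Finset (Fin m)) : Prop :=
  (∀ i, ((E i)ᶜ).card = d i) ∧ (∀ t, Antitone (colSums E t)) ∧
    ∀ i j : Fin r, (i : ℕ) + 1 = j → B j → ∀ x, x ∉ E j → ∀ y, y ∉ E i → x < y

/-- The set with index i holds the columns with entry i + 1, so an (i, i+1)-strip compares the sets
i - 1 and i. The bound `ha` keeps the prescribed weights from truncating. -/
theorem mem_tableauxWithStrips_iff {n r : ℕ} {a : Fin (r + 1) → ℕ} {A : Set (Fin (r + 1))}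
    {B : ℕ → Prop} (hB : ∀ i : Fin (r + 1), B i ↔ i ∉ A)
    (ha : ∀ i : Fin r, a i.succ - a i.castSucc ≤ n - 1)
    (μ : BoxPartition r (n - 1)) (T : SemistandardYoungTableau μ.1) :
    T ∈ tableauxWithStrips n r a A μ.1 ↔
      (∀ c ∈ μ.1.cells, 1 ≤ T c.1 c.2 ∧ T c.1 c.2 ≤ r) ∧
        IsColSequence (fun i => a i.succ - a i.castSucc) B (tableauColSets T (n - 1) r) := by
  have hm : ∀ c ∈ μ.1.cells, c.2 < n - 1 := fun c hc => (μ.2 c hc).2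
  rw [tableauxWithStrips, Set.mem_ofPred_eq]
  refine and_congr_right fun hT => ?_
  rw [IsColSequence, and_iff_right (colSums_tableauColSets_antitone hT _)]
  refine and_congr (forall_congr' fun i => ?_) ?_
  · rw [tableauWeight_eq_card hm, Finset.card_compl, Fintype.card_fin]
    have h1 := ha i
    have h2 := Finset.card_le_univ (tableauColSets T (n - 1) r i)
    rw [Fintype.card_fin] at h2
    simp only [tableauColSets] at h2 ⊢
    omega
  · simp only [exists_isConsecutiveStrip_iff hm]
    constructor
    · intro h i j hij hj
      have := h j.castSucc (by rw [Ne, Fin.ext_iff]; simp; omega) (Fin.castSucc_lt_last j).ne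
        ((hB j.castSucc).1 (by simpa using hj))
      simpa [tableauColSets, hij] using this
    · intro h i hi0 hir hiA
      have h1 : (i : ℕ) ≠ 0 := fun h => hi0 (Fin.ext h)
      have h2 : (i : ℕ) < r := by
        have := i.isLt
        have : (i : ℕ) ≠ r := fun h => hir (Fin.ext h)
        omega
      have := h ⟨i - 1, by omega⟩ ⟨i, h2⟩ (by simp only; omega) ((hB i).2 hiA)
      simpa [tableauColSets, Nat.sub_add_cancel (Nat.pos_of_ne_zero h1)] using this

/-- Tableaux are in bijection with sequences of sets of columns. -/
theorem ncard_tableauxWithStrips {n r : ℕ} {a : Fin (r + 1) → ℕ} {A : Set (Fin (r + 1))}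
    {B : ℕ → Prop} (hB : ∀ i : Fin (r + 1), B i ↔ i ∉ A)
    (ha : ∀ i : Fin r, a i.succ - a i.castSucc ≤ n - 1) (μ : BoxPartition r (n - 1)) :
    (tableauxWithStrips n r a A μ.1).ncard =
      {E : Fin r → Finset (Fin (n - 1)) | IsColSequence (fun i => a i.succ - a i.castSucc) B E ∧
        ∀ c, colSums E r c = μ.1.colLen c}.ncard := by
  have hm : ∀ c ∈ μ.1.cells, c.2 < n - 1 := fun c hc => (μ.2 c hc).2
  refine Set.ncard_congr (fun T _ => tableauColSets T (n - 1) r) ?_ ?_ ?_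
  · intro T hT
    rw [mem_tableauxWithStrips_iff hB ha] at hT
    exact ⟨hT.2, colSums_tableauColSets_eq_colLen hT.1⟩
  · intro T T' hT hT' h
    rw [mem_tableauxWithStrips_iff hB ha] at hT hT'
    exact tableauColSets_injective hm hT.1 hT'.1 h
  · rintro E ⟨hE, hμ⟩
    refine ⟨tableauOfCols hm hμ hE.2.1, ?_, tableauColSets_tableauOfCols hm hμ hE.2.1⟩
    rw [mem_tableauxWithStrips_iff hB ha, tableauColSets_tableauOfCols]
    exact ⟨tableauOfCols_mem_range hm hμ hE.2.1, hE⟩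

/-! ## Merging consecutive sets of columns -/

theorem colSums_congr_of_le {k m : ℕ} {E F : Fin k → Finset (Fin m)} {u t : ℕ}
    (h : colSums E u = colSums F u) (hut : u ≤ t)
    (hEF : ∀ i : Fin k, u ≤ i → (i : ℕ) < t → E i = F i) : colSums E t = colSums F t := by
  induction t, hut using Nat.le_induction with
  | base => exact h
  | succ t hut ih =>
    have ih' := ih fun i hi hit => hEF i hi (hit.trans t.lt_succ_self)
    rcases Nat.lt_or_ge t k with htk | htk
    · have h1 := colSums_succ E ⟨t, htk⟩
      have h2 := colSums_succ F ⟨t, htk⟩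
      simp only at h1 h2
      rw [h1, h2, ih', hEF ⟨t, htk⟩ hut t.lt_succ_self]
    · rw [colSums_of_le E (htk.trans t.le_succ), colSums_of_le F (htk.trans t.le_succ),
        ← colSums_of_le E htk, ← colSums_of_le F htk, ih']

/-- Only the partial sum at t = j contains the set i but not the set j. -/
theorem colSums_eq_of_pair {k m : ℕ} {E F : Fin k → Finset (Fin m)} {i j : Fin k}
    (hij : (i : ℕ) + 1 = j) (hEF : ∀ l, l ≠ i → l ≠ j → E l = F l)
    (h : colIndicator (E i) + colIndicator (E j) = colIndicator (F i) + colIndicator (F j))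
    {t : ℕ} (ht : t ≠ j) : colSums E t = colSums F t := by
  have hle : ∀ t : ℕ, t ≤ i → colSums E t = colSums F t := fun t ht =>
    colSums_congr_of_le (by rw [colSums_zero, colSums_zero]) (Nat.zero_le t) fun l _ hl =>
      hEF l (fun h => by subst h; omega) (fun h => by subst h; omega)
  rcases Nat.lt_or_ge i t with hit | hit
  · have hj : colSums E (j + 1) = colSums F (j + 1) := by
      rw [colSums_succ, colSums_succ, ← hij, colSums_succ, colSums_succ, hle _ le_rfl, add_assoc, h,
        ← add_assoc]
    exact colSums_congr_of_le hj (by omega) fun l hl _ =>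
      hEF l (fun h => by subst h; omega) (fun h => by subst h; omega)
  · exact hle t hit

theorem Finset.split_unique {α : Type*} [LinearOrder α] {L U L' U' : Finset α}
    (h : ∀ x ∈ L, ∀ y ∈ U, x < y) (h' : ∀ x ∈ L', ∀ y ∈ U', x < y) (hun : L ∪ U = L' ∪ U')
    (hcard : L.card = L'.card) : L = L' ∧ U = U' := by
  have hL : L = L' := by
    by_cases hs : L ⊆ L'
    · exact Finset.eq_of_subset_of_card_le hs hcard.ge
    · obtain ⟨x, hx, hx'⟩ := Finset.not_subset.1 hs
      have hxU : x ∈ U' := (Finset.mem_union.1 (hun ▸ Finset.mem_union_left U hx)).resolve_left hx'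
      refine (Finset.eq_of_subset_of_card_le (fun y hy => ?_) hcard.le).symm
      have hyx := h' y hy x hxU
      refine (Finset.mem_union.1 (hun.symm ▸ Finset.mem_union_left U' hy)).resolve_right
        fun hyU => ?_
      exact (h x hx y hyU).not_gt hyx
  refine ⟨hL, ?_⟩
  subst hL
  have hd : Disjoint L U := Finset.disjoint_left.2 fun x hx hx' => (h x hx x hx').false
  have hd' : Disjoint L U' := Finset.disjoint_left.2 fun x hx hx' => (h' x hx x hx').false
  rw [← Finset.union_sdiff_cancel_left hd, hun, Finset.union_sdiff_cancel_left hd']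

theorem Finset.exists_split {α : Type*} [LinearOrder α] (k l : ℕ) : ∀ D : Finset α,
    D.card = k + l → ∃ L U : Finset α, L ∪ U = D ∧ (∀ x ∈ L, ∀ y ∈ U, x < y) ∧ L.card = k ∧
      U.card = l := by
  induction k with
  | zero => exact fun D hD => ⟨∅, D, by simp, by simp, rfl, by omega⟩
  | succ k ih =>
    intro D hD
    have hne : D.Nonempty := Finset.card_pos.1 (by omega)
    have hmem := D.min'_mem hne
    obtain ⟨L, U, hun, hlt, hL, hU⟩ := ih (D.erase (D.min' hne)) (by
      rw [Finset.card_erase_of_mem hmem]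
      omega)
    have hsub : ∀ y ∈ L ∪ U, D.min' hne < y := fun y hy => by
      rw [hun] at hy
      exact D.min'_lt_of_mem_erase_min' hne hy
    refine ⟨insert (D.min' hne) L, U, ?_, ?_, ?_, hU⟩
    · rw [Finset.insert_union, hun, Finset.insert_erase hmem]
    · intro x hx y hy
      rcases Finset.mem_insert.1 hx with rfl | hx
      · exact hsub y (Finset.mem_union_right _ hy)
      · exact hlt x hx y hy
    · rw [Finset.card_insert_of_notMem, hL]
      exact fun h => (hsub _ (Finset.mem_union_left _ h)).false

/-- Replace the sets `E i` and `E j` by the set of all columns and by `E i ∩ E j`. -/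
def mergeCols {k m : ℕ} (i j : Fin k) (E : Fin k → Finset (Fin m)) : Fin k → Finset (Fin m) :=
  Function.update (Function.update E i Finset.univ) j (E i ∩ E j)

/-- The sizes of the complements after merging. -/
def mergeSizes {k : ℕ} (i j : Fin k) (d : Fin k → ℕ) : Fin k → ℕ :=
  Function.update (Function.update d i 0) j (d i + d j)

section Merge

variable {k m : ℕ} {i j : Fin k} {d : Fin k → ℕ} {B : ℕ → Prop} {E F : Fin k → Finset (Fin m)}

theorem mergeCols_left (hij : i ≠ j) : mergeCols i j E i = Finset.univ := by
  simp [mergeCols, hij]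

theorem mergeCols_right : mergeCols i j E j = E i ∩ E j := by
  simp [mergeCols]

theorem mergeCols_of_ne {l : Fin k} (hi : l ≠ i) (hj : l ≠ j) : mergeCols i j E l = E l := by
  simp [mergeCols, hi, hj]

theorem colIndicator_add_of_lt {E₁ E₂ : Finset (Fin m)} (h : ∀ x, x ∉ E₂ → ∀ y, y ∉ E₁ → x < y) :
    colIndicator E₁ + colIndicator E₂ = colIndicator Finset.univ + colIndicator (E₁ ∩ E₂) := by
  funext c
  have hc : c ∉ E₂ → c ∈ E₁ := fun h2 => by
    by_contra h1
    exact (h c h2 c h1).false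
  simp only [Pi.add_apply, colIndicator, Finset.mem_univ, Finset.mem_inter]
  by_cases h1 : c ∈ E₁ <;> by_cases h2 : c ∈ E₂ <;> simp_all

theorem colSums_mergeCols (hij : (i : ℕ) + 1 = j) (h : ∀ x, x ∉ E j → ∀ y, y ∉ E i → x < y)
    {t : ℕ} (ht : t ≠ j) : colSums E t = colSums (mergeCols i j E) t := by
  have hne : i ≠ j := fun h => by subst h; omega
  refine colSums_eq_of_pair hij (fun l hi hj => (mergeCols_of_ne hi hj).symm) ?_ ht
  rw [mergeCols_left hne, mergeCols_right, colIndicator_add_of_lt h]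

/-- `¬ B i` guarantees that no condition relates E i, which is overwritten, to its predecessor.
Positivity of `d j` is what carries the next strip condition over to the merged set. -/
theorem IsColSequence.mergeCols (hE : IsColSequence d B E) (hij : (i : ℕ) + 1 = j) (hj : B j)
    (hi : ¬ B i) (hd : 0 < d j) :
    IsColSequence (mergeSizes i j d) (fun l => B l ∧ l ≠ j) (mergeCols i j E) := by
  have hne : i ≠ j := fun h => by subst h; omega
  obtain ⟨hcard, hanti, hlt⟩ := hE
  have hlt' := hlt i j hij hj
  refine ⟨fun l => ?_, fun t => ?_, fun l l' hll hl' => ?_⟩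
  · rcases eq_or_ne l j with rfl | hlj
    · rw [mergeCols_right, Finset.compl_inter, Finset.card_union_of_disjoint, hcard, hcard]
      · simp [mergeSizes]
      · refine Finset.disjoint_left.2 fun x hx hx' => ?_
        exact (hlt' x (Finset.mem_compl.1 hx') x (Finset.mem_compl.1 hx)).false
    rcases eq_or_ne l i with rfl | hli
    · rw [mergeCols_left hne]
      simp [mergeSizes, hne]
    · rw [mergeCols_of_ne hli hlj, hcard]
      simp [mergeSizes, hli, hlj]
  · by_cases ht : t = j
    · subst ht
      rw [← hij, colSums_succ, mergeCols_left hne, ← colSums_mergeCols hij hlt' (by omega)]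
      intro c c' hc
      have := hanti i hc
      simpa [colIndicator] using this
    · rw [← colSums_mergeCols hij hlt' ht]
      exact hanti t
  · have hl'j : l' ≠ j := fun h => hl'.2 (congrArg Fin.val h)
    have hl'i : l' ≠ i := fun h => hi (h ▸ hl'.1)
    have hli : l ≠ i := fun h => hl'j (Fin.ext (by rw [← hij, ← hll, h]))
    rw [mergeCols_of_ne hl'i hl'j]
    have hl := hlt l l' hll hl'.1
    rcases eq_or_ne l j with rfl | hlj
    · rw [mergeCols_right]
      intro x hx y hy
      rw [Finset.mem_inter, not_and_or] at hy
      rcases hy with hy | hy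
      -- A column z missing from the middle set links the two strip conditions: x < z < y.
      · obtain ⟨z, hz⟩ := Finset.card_pos.1 (by rw [hcard]; exact hd : 0 < ((E l)ᶜ).card)
        rw [Finset.mem_compl] at hz
        exact (hl x hx z hz).trans (hlt' z hz y hy)
      · exact hl x hx y hy
    · rw [mergeCols_of_ne hli hlj]
      exact hl

theorem mergeCols_injOn (hE : IsColSequence d B E) (hF : IsColSequence d B F)
    (hij : (i : ℕ) + 1 = j) (hj : B j) (h : mergeCols i j E = mergeCols i j F) : E = F := by
  have hun : (E j)ᶜ ∪ (E i)ᶜ = (F j)ᶜ ∪ (F i)ᶜ := by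
    rw [← Finset.compl_inter, ← Finset.compl_inter, Finset.inter_comm, Finset.inter_comm (F j),
      ← mergeCols_right, h, mergeCols_right]
  have hs := Finset.split_unique
    (fun x hx y hy => hE.2.2 i j hij hj x (Finset.mem_compl.1 hx) y (Finset.mem_compl.1 hy))
    (fun x hx y hy => hF.2.2 i j hij hj x (Finset.mem_compl.1 hx) y (Finset.mem_compl.1 hy)) hun
    (by rw [hE.1, hF.1])
  funext l
  rcases eq_or_ne l j with rfl | hlj
  · exact compl_injective hs.1
  rcases eq_or_ne l i with rfl | hli
  · exact compl_injective hs.2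
  · rw [← mergeCols_of_ne (E := E) hli hlj, h, mergeCols_of_ne hli hlj]

/-- Undo the merge by cutting the complement of F j into its leftmost `d j` columns, omitted from E
j, and the remaining `d i`, omitted from E i. -/
theorem exists_mergeCols_eq (hij : (i : ℕ) + 1 = j) (hi : ¬ B i)
    (hF : IsColSequence (mergeSizes i j d) (fun l => B l ∧ l ≠ j) F) :
    ∃ E, IsColSequence d B E ∧ mergeCols i j E = F := by
  have hne : i ≠ j := fun h => by subst h; omega
  obtain ⟨hcard, hanti, hlt⟩ := hF
  have hFi : F i = Finset.univ := by
    have := hcard i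
    rw [mergeSizes, Function.update_of_ne hne, Function.update_self, Finset.card_eq_zero,
      Finset.compl_eq_empty_iff] at this
    exact this
  obtain ⟨L, U, hun, hLU, hL, hU⟩ := Finset.exists_split (d j) (d i) (F j)ᶜ (by
    rw [hcard, mergeSizes, Function.update_self, add_comm])
  set E : Fin k → Finset (Fin m) := Function.update (Function.update F i Uᶜ) j Lᶜ with hEdef
  have hEi : E i = Uᶜ := by simp [hEdef, hne]
  have hEj : E j = Lᶜ := by simp [hEdef]
  have hEl : ∀ l, l ≠ i → l ≠ j → E l = F l := fun l hi hj => by simp [hEdef, hi, hj]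
  have hmerge : mergeCols i j E = F := by
    funext l
    rcases eq_or_ne l j with rfl | hlj
    · rw [mergeCols_right, hEi, hEj, ← Finset.compl_union, Finset.union_comm, hun, compl_compl]
    rcases eq_or_ne l i with rfl | hli
    · rw [mergeCols_left hne, hFi]
    · rw [mergeCols_of_ne hli hlj, hEl l hli hlj]
  have hlt' : ∀ x, x ∉ E j → ∀ y, y ∉ E i → x < y := fun x hx y hy => by
    rw [hEj, Finset.notMem_compl] at hx
    rw [hEi, Finset.notMem_compl] at hy
    exact hLU x hx y hy
  refine ⟨E, ⟨fun l => ?_, fun t => ?_, fun l l' hll hl' => ?_⟩, hmerge⟩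
  · rcases eq_or_ne l j with rfl | hlj
    · rw [hEj, compl_compl, hL]
    rcases eq_or_ne l i with rfl | hli
    · rw [hEi, compl_compl, hU]
    · rw [hEl l hli hlj, hcard, mergeSizes, Function.update_of_ne hlj, Function.update_of_ne hli]
  · by_cases ht : t = j
    · subst ht
      have h1 := hanti i
      have h2 := hanti (j + 1)
      rw [colSums_succ, ← hij, colSums_succ, hFi] at h2
      have h3 : colSums E i = colSums F i := by
        rw [colSums_mergeCols hij hlt' (by omega), hmerge]
      rw [← hij, colSums_succ, h3, hEi]
      intro c c' hc
      have h1' := h1 hc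
      have h2' := h2 hc
      simp only [Pi.add_apply, colIndicator, Finset.mem_univ, if_true, Finset.mem_compl] at h2' ⊢
      by_cases hcU : c ∈ U
      · by_cases hcU' : c' ∈ U
        · simpa [hcU, hcU'] using h1'
        -- Here c is omitted from E i and c' is not; c' cannot be in L, which lies to the left of c.
        -- So c' ∈ F j and c ∉ F j, and the monotonicity of the next partial sum of F supplies the
        -- extra unit needed.
        · have hcF : c ∉ F j := Finset.mem_compl.1 (hun ▸ Finset.mem_union_right _ hcU)
          have hcF' : c' ∈ F j := by
            by_contra hn
            rw [← Finset.mem_compl, ← hun, Finset.mem_union] at hn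
            exact (hLU c' (hn.resolve_right hcU') c hcU).not_ge hc
          simp only [hcF, hcF', if_true, if_false] at h2'
          simp only [hcU, hcU', not_true_eq_false, not_false_eq_true, if_true, if_false]
          omega
      · simp only [hcU, not_false_eq_true, if_true]
        split_ifs <;> omega
    · rw [colSums_mergeCols hij hlt' ht, hmerge]
      exact hanti t
  · by_cases hl'j : l' = j
    · subst hl'j
      have : l = i := Fin.ext (by omega)
      rw [this]
      exact hlt'
    · have hl'i : l' ≠ i := fun h => hi (h ▸ hl')
      have hli : l ≠ i := fun h => hl'j (Fin.ext (by rw [← hij, ← hll, h]))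
      have hl := hlt l l' hll ⟨hl', fun h => hl'j (Fin.ext h)⟩
      rw [hEl l' hl'i hl'j]
      rcases eq_or_ne l j with rfl | hlj
      · intro x hx y hy
        refine hl x hx y (Finset.mem_compl.1 (hun ▸ Finset.mem_union_left _ ?_))
        rwa [hEj, Finset.notMem_compl] at hy
      · rw [hEl l hli hlj]
        exact hl

open Classical in
theorem sum_isColSequence_merge {M : Type*} [AddCommMonoid M] (φ : (Fin m → ℕ) → M)
    (hij : (i : ℕ) + 1 = j) (hj : B j) (hi : ¬ B i) (hd : 0 < d j) :
    ∑ E : Fin k → Finset (Fin m) with IsColSequence d B E, φ (colSums E k) =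
      ∑ E : Fin k → Finset (Fin m) with
        IsColSequence (mergeSizes i j d) (fun l => B l ∧ l ≠ j) E, φ (colSums E k) := by
  refine Finset.sum_bij (fun E _ => mergeCols i j E) ?_ ?_ ?_ ?_
  · intro E hE
    rw [Finset.mem_filter] at hE ⊢
    exact ⟨Finset.mem_univ _, hE.2.mergeCols hij hj hi hd⟩
  · intro E hE F hF h
    rw [Finset.mem_filter] at hE hF
    exact mergeCols_injOn hE.2 hF.2 hij hj h
  · intro F hF
    rw [Finset.mem_filter] at hF
    obtain ⟨E, hE, h⟩ := exists_mergeCols_eq hij hi hF.2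
    exact ⟨E, Finset.mem_filter.2 ⟨Finset.mem_univ _, hE⟩, h⟩
  · intro E hE
    rw [Finset.mem_filter] at hE
    rw [colSums_mergeCols hij (hE.2.2.2 i j hij hj) j.isLt.ne']

end Merge

/-! ## Merging all sets of columns within the blocks -/

section Blocks

variable (α : ℕ → ℕ) (A : ℕ → Prop)

open Classical in
/-- The largest element of `A` that is at most `k`. -/
noncomputable def blockStart (k : ℕ) : ℕ := Nat.findGreatest A k

open Classical in
/-- The sizes of the complements after merging the sets with indices less than `t`. -/
noncomputable def mergedSizes (r t : ℕ) (k : Fin r) : ℕ :=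
  if (k : ℕ) + 1 < t then (if A (k + 1) then α (k + 1) - α (blockStart A k) else 0)
  else if (k : ℕ) + 1 = t then α (k + 1) - α (blockStart A k) else α (k + 1) - α k

variable {α A}

theorem blockStart_le (k : ℕ) : blockStart A k ≤ k := by
  classical
  exact Nat.findGreatest_le k

theorem blockStart_eq {u k : ℕ} (hu : A u) (huk : u ≤ k) (h : ∀ x, u < x → x ≤ k → ¬ A x) :
    blockStart A k = u := by
  classical
  exact Nat.findGreatest_eq_iff.2 ⟨huk, fun _ => hu, fun _ h1 h2 => h _ h1 h2⟩

theorem blockStart_succ_of_not {k : ℕ} (h : ¬ A (k + 1)) :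
    blockStart A (k + 1) = blockStart A k := by
  classical
  exact Nat.findGreatest_of_not h

theorem mergedSizes_of_lt {r t : ℕ} {k : Fin r} (h : (k : ℕ) + 1 < t)
    [Decidable (A (k + 1))] :
    mergedSizes α A r t k = if A (k + 1) then α (k + 1) - α (blockStart A k) else 0 := by
  rw [mergedSizes, if_pos h]
  congr

theorem mergedSizes_of_eq {r t : ℕ} {k : Fin r} (h : (k : ℕ) + 1 = t) :
    mergedSizes α A r t k = α (k + 1) - α (blockStart A k) := by
  rw [mergedSizes, if_neg (by omega), if_pos h]

theorem mergedSizes_of_gt {r t : ℕ} {k : Fin r} (h : t < (k : ℕ) + 1) :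
    mergedSizes α A r t k = α (k + 1) - α k := by
  rw [mergedSizes, if_neg (by omega), if_neg (by omega)]

/-- At a block boundary nothing is merged: the accumulated set is complete and the next one starts
afresh. -/
theorem mergedSizes_succ_of_mem {r t : ℕ} (ht : A t) :
    mergedSizes α A r (t + 1) = mergedSizes α A r t := by
  classical
  funext k
  rcases lt_trichotomy ((k : ℕ) + 1) t with h | h | h
  · rw [mergedSizes_of_lt (by omega), mergedSizes_of_lt h]
  · rw [mergedSizes_of_lt (by omega), mergedSizes_of_eq h, if_pos (h ▸ ht)]
  · rw [mergedSizes_of_gt h]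
    by_cases hk : (k : ℕ) = t
    · rw [mergedSizes_of_eq (by omega), hk, blockStart_eq ht le_rfl fun x h1 h2 => by omega]
    · rw [mergedSizes_of_gt (by omega)]

theorem mergedSizes_succ_of_not (hα : Monotone α) {r : ℕ} {i j : Fin r} (hij : (i : ℕ) + 1 = j)
    (hj : ¬ A j) : mergedSizes α A r (j + 1) = mergeSizes i j (mergedSizes α A r j) := by
  classical
  funext k
  rcases eq_or_ne k j with rfl | hkj
  · rw [mergeSizes, Function.update_self, mergedSizes_of_eq rfl, mergedSizes_of_eq hij,
      mergedSizes_of_gt (Nat.lt_succ_self _), ← hij, blockStart_succ_of_not (hij ▸ hj)]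
    have h1 := hα ((blockStart_le (A := A) i).trans (i : ℕ).le_succ)
    have h2 := hα ((i : ℕ) + 1).le_succ
    simp only [Nat.succ_eq_add_one] at h1 h2
    omega
  have hkj' : (k : ℕ) ≠ j := fun h => hkj (Fin.ext h)
  rcases eq_or_ne k i with rfl | hki
  · rw [mergeSizes, Function.update_of_ne hkj, Function.update_self,
      mergedSizes_of_lt (by omega), if_neg (by rwa [hij])]
  · have hki' : (k : ℕ) ≠ i := fun h => hki (Fin.ext h)
    rw [mergeSizes, Function.update_of_ne hkj, Function.update_of_ne hki]
    rcases Nat.lt_or_ge ((k : ℕ) + 1) j with h | h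
    · rw [mergedSizes_of_lt (by omega), mergedSizes_of_lt h]
    · rw [mergedSizes_of_gt (by omega), mergedSizes_of_gt (by omega)]

-- Merges from left to right: at each step that is not a boundary, the accumulated set of the block
-- absorbs its successor. The conditions below the current index are already gone, and the
-- successor's complement is nonempty because α increases strictly.
open Classical in
theorem sum_isColSequence_mergedSizes {M : Type*} [AddCommMonoid M] {r m : ℕ}
    (φ : (Fin m → ℕ) → M) (hα : Monotone α) (hα' : ∀ k < r, α k < α (k + 1)) (t : ℕ)
    (ht : t + 1 ≤ r) :
    ∑ E : Fin r → Finset (Fin m) with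
        IsColSequence (mergedSizes α A r 1) (fun k => 1 ≤ k ∧ ¬ A k) E, φ (colSums E r) =
      ∑ E : Fin r → Finset (Fin m) with
        IsColSequence (mergedSizes α A r (t + 1)) (fun k => t + 1 ≤ k ∧ ¬ A k) E,
          φ (colSums E r) := by
  induction t with
  | zero => rfl
  | succ t ih =>
    rw [ih (by omega)]
    by_cases hA : A (t + 1)
    · have hB : (fun k => t + 1 ≤ k ∧ ¬ A k) = fun k => t + 1 + 1 ≤ k ∧ ¬ A k := by
        funext k
        refine propext (and_congr_left fun hk => ⟨fun h => ?_, fun h => by omega⟩)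
        have : t + 1 ≠ k := fun h => hk (h ▸ hA)
        omega
      rw [mergedSizes_succ_of_mem hA, hB]
    · have hB : (fun k => t + 1 + 1 ≤ k ∧ ¬ A k) =
          fun k => (t + 1 ≤ k ∧ ¬ A k) ∧ k ≠ t + 1 := by
        funext k
        refine propext ⟨fun h => ⟨⟨by omega, h.2⟩, by omega⟩, fun h => ⟨by omega, h.1.2⟩⟩
      have hmerge := mergedSizes_succ_of_not hα (i := (⟨t, by omega⟩ : Fin r))
        (j := ⟨t + 1, by omega⟩) rfl hA
      simp only at hmerge
      rw [hmerge, hB]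
      refine sum_isColSequence_merge φ (i := ⟨t, by omega⟩) (j := ⟨t + 1, by omega⟩)
        (B := fun k => t + 1 ≤ k ∧ ¬ A k) rfl ⟨le_rfl, hA⟩ (fun h => by simp at h) ?_
      have := hα' (t + 1) (by omega)
      rw [mergedSizes_of_gt (by simp only; omega)]
      exact Nat.sub_pos_of_lt this

theorem mergedSizes_one (r : ℕ) (k : Fin r) : mergedSizes α A r 1 k = α (k + 1) - α k := by
  rcases Nat.eq_zero_or_pos k with h | h
  · rw [mergedSizes_of_eq (by omega), h, Nat.le_zero.1 (blockStart_le (A := A) 0)]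
  · rw [mergedSizes_of_gt (by omega)]

theorem mergedSizes_self {r : ℕ} (hr : A r) (k : Fin r) [Decidable (A (k + 1))] :
    mergedSizes α A r r k = if A (k + 1) then α (k + 1) - α (blockStart A k) else 0 := by
  rcases Nat.lt_or_ge ((k : ℕ) + 1) r with h | h
  · exact mergedSizes_of_lt h
  · have h' : (k : ℕ) + 1 = r := by omega
    rw [mergedSizes_of_eq h', if_pos (by rwa [h'])]

theorem prod_range_eq_prod_blocks {M : Type*} [CommMonoid M] (f : ℕ → M) :
    ∀ (ℓ : ℕ) (s : Fin (ℓ + 1) → ℕ), Monotone s → s 0 = 0 →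
      ∏ k ∈ Finset.range (s (Fin.last ℓ)), f k =
        ∏ j : Fin ℓ, ∏ k ∈ Finset.Ico (s j.castSucc) (s j.succ), f k
  | 0, s, _, h0 => by
    simp [h0]
  | ℓ + 1, s, hs, h0 => by
    rw [Fin.prod_univ_castSucc]
    have ih := prod_range_eq_prod_blocks f ℓ (s ∘ Fin.castSucc)
      (hs.comp Fin.strictMono_castSucc.monotone) h0
    simp only [Function.comp_apply] at ih
    simp only [← Fin.castSucc_succ]
    rw [← ih, Fin.succ_last, Finset.prod_range_mul_prod_Ico _ (hs (Fin.le_last _))]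

end Blocks

/-! ## The partition with given column lengths -/

/-- The partition with given column lengths. -/
def boxPartitionOfCols (r : ℕ) {m : ℕ} (g : Fin m → ℕ) (hg : Antitone g) : BoxPartition r m :=
  ⟨{ cells := (Finset.range r ×ˢ Finset.range m).filter fun b =>
        ∃ h : b.2 < m, b.1 < g ⟨b.2, h⟩
     isLowerSet := by
        rintro ⟨x, c⟩ ⟨x', c'⟩ ⟨hx, hc⟩ hb
        simp only [Finset.coe_filter, Finset.mem_product, Finset.mem_range,
          Set.mem_ofPred_eq] at hb hx hc ⊢
        obtain ⟨⟨h1, h2⟩, h3, h4⟩ := hb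
        exact ⟨⟨by omega, by omega⟩, by omega, hx.trans_lt (h4.trans_le (hg (by exact hc)))⟩ },
    by
      intro b hb
      simp only [Finset.mem_filter, Finset.mem_product, Finset.mem_range] at hb
      exact hb.1⟩

theorem boxPartitionOfCols_colLen {r m : ℕ} {g : Fin m → ℕ} (hg : Antitone g)
    (hr : ∀ c, g c ≤ r) (c : Fin m) : (boxPartitionOfCols r g hg).1.colLen c = g c := by
  refine eq_of_forall_lt_iff fun x => ?_
  rw [← YoungDiagram.mem_iff_lt_colLen, ← YoungDiagram.mem_cells]
  simp only [boxPartitionOfCols, Finset.mem_filter, Finset.mem_product, Finset.mem_range]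
  exact ⟨fun h => h.2.2, fun h => ⟨⟨h.trans_le (hr c), c.isLt⟩, c.isLt, h⟩⟩

namespace BoxPartition

variable {r m : ℕ}

theorem ext_colLen {μ ν : BoxPartition r m} (h : ∀ c : Fin m, μ.1.colLen c = ν.1.colLen c) :
    μ = ν := by
  have key : ∀ {κ ρ : BoxPartition r m}, (∀ c : Fin m, κ.1.colLen c = ρ.1.colLen c) →
      κ.1.cells ⊆ ρ.1.cells := by
    intro κ ρ h b hb
    have h1 := h ⟨b.2, (κ.2 b hb).2⟩
    rw [YoungDiagram.mem_cells] at hb ⊢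
    exact YoungDiagram.mem_iff_lt_colLen.2 (h1 ▸ YoungDiagram.mem_iff_lt_colLen.1 hb)
  exact Subtype.ext (YoungDiagram.ext (Finset.Subset.antisymm (key h) (key fun c => (h c).symm)))

theorem parts_eq_rowsOfCols (μ : BoxPartition r m) :
    μ.parts = rowsOfCols r fun c : Fin m => μ.1.colLen c := by
  funext i
  have h : (Finset.univ.filter fun c : Fin m => (i : ℕ) < μ.1.colLen c) =
      Finset.univ.filter fun c : Fin m => (c : ℕ) < μ.parts i :=
    Finset.filter_congr fun c _ => by
      rw [← YoungDiagram.mem_iff_lt_colLen, YoungDiagram.mem_iff_lt_rowLen]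
      rfl
  rw [rowsOfCols, h, Fin.card_filter_val_lt, min_eq_right (μ.parts_le i)]

theorem card_eq_sum_colLen (μ : BoxPartition r m) : μ.1.card = ∑ c : Fin m, μ.1.colLen c := by
  rw [YoungDiagram.card, Finset.card_eq_sum_card_fiberwise (f := Prod.snd)
    (t := Finset.range m) fun b hb => Finset.mem_coe.2 (Finset.mem_range.2 (μ.2 b hb).2),
    Fin.sum_univ_eq_sum_range fun c => μ.1.colLen c]
  exact Finset.sum_congr rfl fun c _ => (YoungDiagram.colLen_eq_card _).symm

end BoxPartition

/-! ### Grouping column sequences by shape and evaluating the merged sum -/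

theorem sum_colSums {k m : ℕ} (E : Fin k → Finset (Fin m)) :
    ∑ c, colSums E k c = ∑ i, (E i).card := by
  simp only [colSums_eq_sum, Fin.is_lt, if_true]
  rw [Finset.sum_comm]
  refine Finset.sum_congr rfl fun i _ => ?_
  simp [colIndicator]

open Classical in
/-- The sum over all tableaux as a sum over sequences of sets of columns. -/
theorem sum_ncard_smul_schubertClass {r m w : ℕ} {d : Fin r → ℕ} {B : ℕ → Prop}
    (hw : w + ∑ i, d i = r * m) (N : ℕ) :
    ∑ μ : BoxPartition r m with μ.1.card = w,
        (({E : Fin r → Finset (Fin m) | IsColSequence d B E ∧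
          ∀ c, colSums E r c = μ.1.colLen c}.ncard : ℕ) : ℤ) • schubertClass r N μ.parts =
      ∑ E : Fin r → Finset (Fin m) with IsColSequence d B E,
        schubertClass r N (rowsOfCols r (colSums E r)) := by
  have hterm : ∀ μ : BoxPartition r m,
      (({E : Fin r → Finset (Fin m) | IsColSequence d B E ∧
          ∀ c, colSums E r c = μ.1.colLen c}.ncard : ℕ) : ℤ) • schubertClass r N μ.parts =
        ∑ E : Fin r → Finset (Fin m) with IsColSequence d B E,
          if ∀ c, colSums E r c = μ.1.colLen c then schubertClass r N μ.parts else 0 := by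
    intro μ
    rw [← Finset.sum_filter, Finset.filter_filter, Finset.sum_const, natCast_zsmul,
      Set.ncard_eq_toFinset_card', Set.toFinset_ofPred]
  simp only [hterm]
  rw [Finset.sum_comm]
  refine Finset.sum_congr rfl fun E hE => ?_
  have hE' := (Finset.mem_filter.1 hE).2
  have hcol := boxPartitionOfCols_colLen (r := r) (hE'.2.1 r) (colSums_le E r)
  set ν := boxPartitionOfCols r (colSums E r) (hE'.2.1 r) with hν
  rw [Finset.sum_eq_single ν]
  · rw [if_pos fun c => (hcol c).symm, ν.parts_eq_rowsOfCols]
    congr 2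
    exact funext hcol
  · intro μ _ hμ
    rw [if_neg]
    exact fun h => hμ (BoxPartition.ext_colLen fun c => (h c).symm.trans (hcol c).symm)
  · intro h
    refine absurd (Finset.mem_filter.2 ⟨Finset.mem_univ _, ?_⟩) h
    -- The size of the shape is forced: it is the total size of the sets E i, namely r m - ∑ d_i.
    rw [ν.card_eq_sum_colLen, Finset.sum_congr rfl fun c _ => hcol c, sum_colSums]
    have hcard : ∀ i, (E i).card + d i = m := fun i => by
      rw [← hE'.1 i, Finset.card_add_card_compl, Fintype.card_fin]
    have := Finset.sum_congr (rfl : (Finset.univ : Finset (Fin r)) = _) fun i _ => hcard i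
    rw [Finset.sum_add_distrib, Finset.sum_const, Finset.card_univ, Fintype.card_fin,
      smul_eq_mul] at this
    omega

section Main

variable {α : ℕ → ℕ} {A : ℕ → Prop}

-- After complete merging no strip condition is left, so the sum is that of the iterated rule of
-- Pieri.
open Classical in
theorem sum_isColSequence_schubertClass {r m : ℕ} (hr : 1 ≤ r) (hα : Monotone α)
    (hα' : ∀ k < r, α k < α (k + 1)) (hA : A r) (hm : ∀ k ≤ r, α k - α 0 ≤ m) :
    ∑ E : Fin r → Finset (Fin m) with
        IsColSequence (fun i => α (i + 1) - α i) (fun k => 1 ≤ k ∧ ¬ A k) E,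
        schubertClass r (m + r) (rowsOfCols r (colSums E r)) =
      ∏ i : Fin r, pieriClass r (m + r)
        (if A (i + 1) then m - (α (i + 1) - α (blockStart A i)) else m) := by
  have h1 : (fun i : Fin r => α (i + 1) - α i) = mergedSizes α A r 1 :=
    funext fun i => (mergedSizes_one r i).symm
  rw [h1, sum_isColSequence_mergedSizes (fun g => schubertClass r (m + r) (rowsOfCols r g)) hα hα'
    (r - 1) (by omega), Nat.sub_add_cancel hr, prod_pieriClass r le_rfl]
  refine Finset.sum_congr (Finset.filter_congr fun E _ => ?_) fun _ _ => rfl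
  rw [IsColSequence]
  refine and_congr (forall_congr' fun i => ?_) (and_iff_left fun i j _ hj => ?_)
  · have h2 := hm (i + 1) i.isLt
    have h3 := hα (Nat.zero_le (blockStart A i))
    have h4 := Finset.card_le_univ (E i)
    rw [Fintype.card_fin] at h4
    rw [mergedSizes_self hA, Finset.card_compl, Fintype.card_fin]
    split_ifs <;> omega
  · exact absurd hj.1 (not_le.2 j.isLt)

-- Within a block every factor but the last is σ_m.
open Classical in
theorem prod_Ico_pieriClass {r m u v : ℕ} (huv : u < v) (hvr : v ≤ r) (hu : A u) (hv : A v)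
    (h : ∀ x, u < x → x < v → ¬ A x) :
    ∏ k ∈ Finset.Ico u v, pieriClass r (m + r)
        (if A (k + 1) then m - (α (k + 1) - α (blockStart A k)) else m) =
      schubertClass r (m + r) (rectanglePlusPart r m (v - u - 1) (m - (α v - α u))) := by
  obtain ⟨w, rfl⟩ : ∃ w, v = w + 1 := ⟨v - 1, by omega⟩
  rw [Finset.prod_Ico_succ_top (by omega), if_pos hv,
    blockStart_eq hu (by omega) fun x h1 h2 => h x h1 (by omega),
    schubertClass_rectanglePlusPart (Nat.sub_le _ _) (by omega),
    Finset.prod_congr rfl fun k hk => ?_, Finset.prod_const, Nat.card_Ico]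
  · congr 2
    omega
  · rw [Finset.mem_Ico] at hk
    rw [if_neg (h (k + 1) (by omega) (by omega))]

end Main

theorem proposition4p1 (n r ℓ : ℕ) (hr : 1 ≤ r)
    (a : Fin (r + 1) → ℕ) (ha : StrictMono a) (ha0 : a 0 = 1) (har : a (Fin.last r) = n)
    (s : Fin (ℓ + 1) → Fin (r + 1)) (hs : StrictMono s) (hs0 : s 0 = 0)
    (hsl : s (Fin.last ℓ) = Fin.last r) :
    LinearIndependent ℤ
      (fun μ : BoxPartition r (n - 1) => schubertClass r (n + r - 1) μ.parts) ∧
    ∏ j : Fin ℓ, schubertClass r (n + r - 1)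
        (rectanglePlusPart r (n - 1) ((s j.succ : ℕ) - (s j.castSucc : ℕ) - 1)
          (n - 1 - (a (s j.succ) - a (s j.castSucc)))) =
      ∑ μ : BoxPartition r (n - 1) with μ.1.card = (n - 1) * (r - 1),
        ((tableauxWithStrips n r a (Set.range s) μ.1).ncard : ℤ) •
          schubertClass r (n + r - 1) μ.parts := by
  classical
  have hn : 1 ≤ n := by
    rw [← har, ← ha0]
    exact ha.monotone (Fin.zero_le _)
  rw [show n + r - 1 = n - 1 + r by omega]
  refine ⟨linearIndependent_schubertClass hr, ?_⟩
  -- Extending a by its last value to all of ℕ keeps it monotone; strictness is only needed below r.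
  set α : ℕ → ℕ := fun k => a ⟨min k r, by omega⟩ with hαdef
  obtain ⟨A, hA⟩ : ∃ A : ℕ → Prop, ∀ k, A k ↔ ∃ j, (s j : ℕ) = k := ⟨_, fun _ => Iff.rfl⟩
  have hαval : ∀ i : Fin (r + 1), α i = a i := fun i => by
    simp only [hαdef]
    congr 1
    exact Fin.ext (min_eq_left (Nat.lt_succ_iff.1 i.isLt))
  have hα : Monotone α := fun x y h =>
    ha.monotone (Fin.mk_le_mk.2 (min_le_min_right r h))
  have hα' : ∀ k < r, α k < α (k + 1) := fun k hk => ha (Fin.mk_lt_mk.2 (by omega))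
  have hα0 : α 0 = 1 := (hαval 0).trans ha0
  have hαr : α r = n := (hαval (Fin.last r)).trans har
  have hA0 : A 0 := (hA 0).2 ⟨0, by rw [hs0]; rfl⟩
  have hAr : A r := (hA r).2 ⟨Fin.last ℓ, by rw [hsl]; rfl⟩
  have hm : ∀ k ≤ r, α k - α 0 ≤ n - 1 := fun k hk => by
    have := hα hk
    omega
  have hB : ∀ i : Fin (r + 1), (1 ≤ (i : ℕ) ∧ ¬ A i) ↔ i ∉ Set.range s := fun i => by
    have h1 : A i ↔ i ∈ Set.range s := (hA i).trans (exists_congr fun j => Fin.ext_iff.symm)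
    rw [← h1, and_iff_right_iff_imp]
    intro hi
    by_contra h0
    exact hi (by rwa [show (i : ℕ) = 0 by omega])
  have had : (fun i : Fin r => a i.succ - a i.castSucc) = fun i : Fin r => α (i + 1) - α i :=
    funext fun i => by rw [← hαval, ← hαval, Fin.val_succ, Fin.val_castSucc]
  have had' : ∀ i : Fin r, a i.succ - a i.castSucc ≤ n - 1 := fun i => by
    have h1 : α (i + 1) - α 0 ≤ n - 1 := hm _ i.isLt
    have h2 := hα (Nat.zero_le i)
    rw [congrFun had i]
    omega
  simp only [ncard_tableauxWithStrips (B := fun k => 1 ≤ k ∧ ¬ A k) hB had', had]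
  -- The differences telescope to n - 1, which accounts for the size (n - 1)(r - 1) of the shapes.
  have hw : (n - 1) * (r - 1) + ∑ i : Fin r, (α (i + 1) - α i) = r * (n - 1) := by
    rw [Fin.sum_univ_eq_sum_range fun i => α (i + 1) - α i, Finset.sum_range_tsub hα, hα0, hαr,
      mul_comm r, ← Nat.mul_succ, Nat.succ_eq_add_one, Nat.sub_add_cancel hr]
  rw [sum_ncard_smul_schubertClass hw, sum_isColSequence_schubertClass hr hα hα' hAr hm,
    Fin.prod_univ_eq_prod_range (fun i => pieriClass r (n - 1 + r)
      (if A (i + 1) then n - 1 - (α (i + 1) - α (blockStart A i)) else n - 1))]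
  have hblocks := prod_range_eq_prod_blocks (fun i => pieriClass r (n - 1 + r)
      (if A (i + 1) then n - 1 - (α (i + 1) - α (blockStart A i)) else n - 1)) ℓ
      (fun j => (s j : ℕ)) (fun x y h => hs.monotone h) (by simp only [hs0]; rfl)
  simp only [hsl, Fin.val_last] at hblocks
  rw [hblocks]
  refine Finset.prod_congr rfl fun j _ => ?_
  rw [prod_Ico_pieriClass (hs j.castSucc_lt_succ) (Nat.lt_succ_iff.1 (s j.succ).isLt)
    ((hA _).2 ⟨_, rfl⟩) ((hA _).2 ⟨_, rfl⟩), hαval, hαval]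
  intro x h1 h2 hx
  obtain ⟨i, rfl⟩ := (hA x).1 hx
  have h3 : j.castSucc < i := hs.lt_iff_lt.1 h1
  have h4 : i < j.succ := hs.lt_iff_lt.1 h2
  simp only [Fin.lt_def, Fin.val_castSucc, Fin.val_succ] at h3 h4
  omega
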